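/- **Setting.** Let $\mathbb G_1,\mathbb G_2$ be cyclic groups of prime order $p$, whose elements are represented by bit strings, and let $e\colon \mathbb G_1\times\mathbb G_1\to\mathbb G_2$ be a cryptographic pairing: $e(x^a,y^b)=e(x,y)^{ab}$ for all $x,y\in\mathbb G_1$, $a,b\in\mathbb Z$, and $e(g,g)$ generates $\mathbb G_2$ whenever $g$ generates $\mathbb G_1$. Algorithms and interactive machines are probabilistic programs which may use bits, lists, $\mathbb Z_p$, $\mathbb G_1$, $\mathbb G_2$, $e$, encoding and decoding of elements by bit strings, uniform random elements, conditionals and bounded loops; they may be nonuniform, and their running time is the total cost of their instructions (loops unrolled, both branches of a conditional counted; a basic operation $o$ has an arbitrary given cost $\kappa(o)+1$, every other instruction has cost $1$). Let $\tau=\sum_o(\kappa(o)+1)$ be the total cost of the basic operations. The pairing $e$ is *$(t',\epsilon')$-one-way* if every algorithm $\mathcal C$ with running time at most $t'$ satisfies $\Pr[e(g,\mathcal C(g,x))=x]<\epsilon'$, for uniform $g\in\mathbb G_1$, $x\in\mathbb G_2$ and the coins of $\mathcal C$. A triple $(\mathcal G,\mathcal P,\mathcal V)$ of a key generator, a prover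 and a verifier is a *$(t,q,\epsilon)$-identification scheme* if $\mathcal P$ and $\mathcal V$ run in time at most $t$ and, for every bit string $\alpha$ and the random key pair $(a,p_a)=\mathcal G(\alpha)$: (viability) $\mathcal V(p_a)$ accepts $\mathcal P(a,p_a)$ with probability $1$; (security under active attack) for every machine $\mathcal B$ of total running time at most $t$, with output $T$ on input $p_a$ after $q$ consecutive interactions with $\mathcal P(a,p_a)$, and every machine $\mathcal A$ of running time at most $t$, $\Pr[\mathcal A(p_a,T)\text{ makes }\mathcal V(p_a)\text{ accept}]<\epsilon$, where the probability is over the key generation and all coins. **Protocol.** Key generation: random $P,Q\in\mathbb G_1$, $y\in\mathbb G_2$, $s\in\mathbb Z_p^*$; the public key is $(P,y,v)$ with $v=e(P,Q)^{-1}y^{-s}$, the private key is $(Q,s)$. Interaction: (1) the prover chooses random $R\in\mathbb G_1$, $r\in\mathbb Z_p$ and sends $x=e(P,R)\,y^r$; (2) the verifier sends a random $m\in\mathbb Z_p^*$; (3) the prover sends $T=R\,Q^m$ and $a=r+ms$; (4) the verifier accepts if and only if $e(P,T)\,y^a\,v^m=x$. **Theorem.** There are absolute constants $k_0,k_s$ such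 that the following holds for all $p,\mathbb G_1,\mathbb G_2,e$ and costs $\kappa$ as above, with $c_0=k_0\tau$ and $c_s=k_s\tau$. Suppose that $e$ is a $(t',\epsilon')$-one-way pairing, where $\epsilon'\le 3/16$ and $p\ge 17$. Let $q\ge 1$, and let $t$ be at least the running time of the honest prover and of the honest verifier. If $$\epsilon>\frac2p\qquad\text{and}\qquad c_0+\frac{3(t+c_sq)}{\epsilon}\le t',$$ then the key generation runs in time at most $c_0$ and the protocol is a $(t,q,\epsilon)$-identification scheme. -/

import Mathlib

noncomputable section

/-- `e : G₁ × G₁ → G₂` is a cryptographic pairing: it is bilinear and non-degenerate. -/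
structure IsCryptographicPairing {G₁ : Type*} {G₂ : Type*} [CommGroup G₁] [CommGroup G₂]
    (e : G₁ → G₁ → G₂) : Prop where
  bilinear : ∀ (x y : G₁) (a b : ℤ), e (x ^ a) (y ^ b) = e x y ^ (a * b)
  nondegenerate : ∀ g : G₁, (∀ x : G₁, x ∈ Subgroup.zpowers g) →
    ∀ z : G₂, z ∈ Subgroup.zpowers (e g g)

/-! ## The machine model

Programs act on immutable binary trees whose leaves are `nil`, elements of `ZMod p`, and elements
of the two groups. `nil` is the Boolean `false`, every other value counts as `true`. -/

/-- The values on which programs compute. -/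
inductive Val (p : ℕ) (G₁ : Type*) (G₂ : Type*) where
  | nil : Val p G₁ G₂
  | zp (z : ZMod p) : Val p G₁ G₂
  | g1 (g : G₁) : Val p G₁ G₂
  | g2 (g : G₂) : Val p G₁ G₂
  | pair (a b : Val p G₁ G₂) : Val p G₁ G₂

namespace Val

variable {p : ℕ} {G₁ : Type*} {G₂ : Type*}

/-- First component (`nil` if the value is not a pair). -/
def fst : Val p G₁ G₂ → Val p G₁ G₂
  | pair a _ => a
  | _ => nil

/-- Second component (`nil` if the value is not a pair). -/
def snd : Val p G₁ G₂ → Val p G₁ G₂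
  | pair _ b => b
  | _ => nil

/-- The truth value of a value: everything except `nil` is true. -/
def truth : Val p G₁ G₂ → Bool
  | nil => false
  | _ => true

/-- Booleans as values. -/
def ofBool : Bool → Val p G₁ G₂
  | true => pair nil nil
  | false => nil

/-- Bit strings as values. -/
def ofBits : List Bool → Val p G₁ G₂
  | [] => nil
  | b :: l => pair (ofBool b) (ofBits l)

/-- The bit string represented by a value. -/
def toBits : Val p G₁ G₂ → List Bool
  | pair a b => a.truth :: b.toBits
  | _ => []

end Val

/-- The basic operations. They are applied to a single value, which is a pair for the binary
operations; on an argument of the wrong sort the result is `nil`. -/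
inductive Op where
  /-- is the argument a pair? -/
  | isPair
  /-- equality of two elements of `ZMod p`, of `G₁`, or of `G₂` -/
  | eq
  /-- fair coin -/
  | coin
  | zeroZ
  | oneZ
  | addZ
  | negZ
  | mulZ
  | invZ
  /-- uniform element of `ZMod p` -/
  | randZ
  /-- uniform nonzero element of `ZMod p` -/
  | randUnitZ
  | one1
  | mul1
  | inv1
  /-- `(g, z) ↦ g ^ z` in `G₁` -/
  | pow1
  /-- uniform element of `G₁` -/
  | rand1
  | one2
  | mul2
  | inv2
  /-- `(g, z) ↦ g ^ z` in `G₂` -/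
  | pow2
  /-- uniform element of `G₂` -/
  | rand2
  /-- `(g, h) ↦ e(g, h)` -/
  | pairing
  /-- the bit string that represents an element of `ZMod p`, `G₁` or `G₂` -/
  | encode
  | decodeZ
  | decode1
  | decode2

/-- The list of all basic operations. -/
def Op.all : List Op :=
  [isPair, eq, coin, zeroZ, oneZ, addZ, negZ, mulZ, invZ, randZ, randUnitZ,
    one1, mul1, inv1, pow1, rand1, one2, mul2, inv2, pow2, rand2, pairing,
    encode, decodeZ, decode1, decode2]

/-- Programs. A program maps one input value to one (random) output value. -/
inductive Prog where
  /-- return the input -/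
  | id
  /-- return `nil` -/
  | nil
  /-- first component of the input -/
  | fst
  /-- second component of the input -/
  | snd
  /-- basic operation -/
  | prim (o : Op)
  /-- run `f`, then run `g` on the result -/
  | seq (f g : Prog)
  /-- run both `f` and `g` on the input and return the pair of the results -/
  | fork (f g : Prog)
  /-- run `c` on the input; if the result is true run `f` on the input, otherwise `g` -/
  | cond (c f g : Prog)
  /-- iterate `f` exactly `n` times -/
  | loop (n : ℕ) (f : Prog)

/-- Running time, where the basic operation `o` takes `κ o + 1` steps and every other instruction
takes one step. Loops are charged for all of their iterations and conditionals for both branches,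
so that this bounds the number of steps in every execution, and the length of the (unrolled)
program as well: as usual for nonuniform algorithms, tables in the code are not free. -/
def Prog.time (κ : Op → ℕ) : Prog → ℕ
  | .id => 1
  | .nil => 1
  | .fst => 1
  | .snd => 1
  | .prim o => κ o + 1
  | .seq f g => 1 + f.time κ + g.time κ
  | .fork f g => 1 + f.time κ + g.time κ
  | .cond c f g => 1 + c.time κ + f.time κ + g.time κ
  | .loop n f => 1 + n * f.time κ

/-- The total cost of all the basic operations, each performed once. -/
def totalOpCost (κ : Op → ℕ) : ℕ := (Op.all.map fun o => κ o + 1).sum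

/-- What a computer needs to know about the groups: the map `e`, and the representation of the
elements of the two groups by bit strings. -/
structure Setting (G₁ : Type*) (G₂ : Type*) where
  e : G₁ → G₁ → G₂
  enc₁ : G₁ ↪ List Bool
  enc₂ : G₂ ↪ List Bool

section Semantics

variable {p : ℕ} [Fact p.Prime] {G₁ : Type*} {G₂ : Type*} [CommGroup G₁] [CommGroup G₂]
  [Fintype G₁] [Fintype G₂]

open Classical in
/-- The value of a basic operation, as a probability distribution. -/
def Op.eval (S : Setting G₁ G₂) : Op → Val p G₁ G₂ → PMF (Val p G₁ G₂)
  | .isPair, v => PMF.pure (match v with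
      | .pair _ _ => .ofBool true
      | _ => .nil)
  | .eq, v => PMF.pure (match v with
      | .pair (.zp a) (.zp b) => .ofBool (decide (a = b))
      | .pair (.g1 a) (.g1 b) => .ofBool (decide (a = b))
      | .pair (.g2 a) (.g2 b) => .ofBool (decide (a = b))
      | _ => .nil)
  | .coin, _ => (PMF.uniformOfFintype Bool).map .ofBool
  | .zeroZ, _ => PMF.pure (.zp 0)
  | .oneZ, _ => PMF.pure (.zp 1)
  | .addZ, v => PMF.pure (match v with
      | .pair (.zp a) (.zp b) => .zp (a + b)
      | _ => .nil)
  | .negZ, v => PMF.pure (match v with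
      | .zp a => .zp (-a)
      | _ => .nil)
  | .mulZ, v => PMF.pure (match v with
      | .pair (.zp a) (.zp b) => .zp (a * b)
      | _ => .nil)
  | .invZ, v => PMF.pure (match v with
      | .zp a => .zp a⁻¹
      | _ => .nil)
  | .randZ, _ => (PMF.uniformOfFintype (ZMod p)).map .zp
  | .randUnitZ, _ => (PMF.uniformOfFintype (ZMod p)ˣ).map fun u => .zp (u : ZMod p)
  | .one1, _ => PMF.pure (.g1 1)
  | .mul1, v => PMF.pure (match v with
      | .pair (.g1 a) (.g1 b) => .g1 (a * b)
      | _ => .nil)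
  | .inv1, v => PMF.pure (match v with
      | .g1 a => .g1 a⁻¹
      | _ => .nil)
  | .pow1, v => PMF.pure (match v with
      | .pair (.g1 a) (.zp z) => .g1 (a ^ z.val)
      | _ => .nil)
  | .rand1, _ => (PMF.uniformOfFintype G₁).map .g1
  | .one2, _ => PMF.pure (.g2 1)
  | .mul2, v => PMF.pure (match v with
      | .pair (.g2 a) (.g2 b) => .g2 (a * b)
      | _ => .nil)
  | .inv2, v => PMF.pure (match v with
      | .g2 a => .g2 a⁻¹
      | _ => .nil)
  | .pow2, v => PMF.pure (match v with
      | .pair (.g2 a) (.zp z) => .g2 (a ^ z.val)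
      | _ => .nil)
  | .rand2, _ => (PMF.uniformOfFintype G₂).map .g2
  | .pairing, v => PMF.pure (match v with
      | .pair (.g1 a) (.g1 b) => .g2 (S.e a b)
      | _ => .nil)
  | .encode, v => PMF.pure (match v with
      | .zp z => .ofBits z.val.bits
      | .g1 a => .ofBits (S.enc₁ a)
      | .g2 a => .ofBits (S.enc₂ a)
      | _ => .nil)
  | .decodeZ, v => PMF.pure (.zp ((v.toBits.foldr Nat.bit 0 : ℕ) : ZMod p))
  | .decode1, v => PMF.pure
      (if h : ∃ a, S.enc₁ a = v.toBits then .g1 h.choose else .nil)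
  | .decode2, v => PMF.pure
      (if h : ∃ a, S.enc₂ a = v.toBits then .g2 h.choose else .nil)

/-- The output distribution of a program on a given input. All random choices are independent. -/
def Prog.eval (S : Setting G₁ G₂) : Prog → Val p G₁ G₂ → PMF (Val p G₁ G₂)
  | .id, v => PMF.pure v
  | .nil, _ => PMF.pure .nil
  | .fst, v => PMF.pure v.fst
  | .snd, v => PMF.pure v.snd
  | .prim o, v => o.eval S v
  | .seq f g, v => (f.eval S v).bind fun w => g.eval S w
  | .fork f g, v => (f.eval S v).bind fun a => (g.eval S v).bind fun b => PMF.pure (.pair a b)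
  | .cond c f g, v => (c.eval S v).bind fun b => if b.truth then f.eval S v else g.eval S v
  | .loop n f, v => Nat.rec (PMF.pure v) (fun _ d => d.bind fun w => f.eval S w) n

end Semantics

/-! ## Interactive machines and identification schemes -/

/-- A probabilistic interactive machine that is activated `n` times. On its `i`-th activation it
receives the pair of its state and the incoming message, and it returns the pair of its new state
and the outgoing message. -/
abbrev Machine (n : ℕ) := Fin n → Prog

/-- Total running time of an interactive machine. -/
def Machine.time (κ : Op → ℕ) {n : ℕ} (M : Machine n) : ℕ := ∑ i, (M i).time κ

/-- A cheating verifier against a protocol with `n` rounds, for `q` consecutive sessions: its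
machines for these sessions, and the program that computes its output from its final state. -/
structure CheatingVerifier (n q : ℕ) where
  session : Fin q → Machine n
  output : Prog

/-- Total running time of a cheating verifier. -/
def CheatingVerifier.time (κ : Op → ℕ) {n q : ℕ} (B : CheatingVerifier n q) : ℕ :=
  ∑ j, (B.session j).time κ + B.output.time κ

/-- A triple `(𝒢, 𝒫, 𝒱)`. The key generator maps a bit string to a pair
(private key, public key); in each of the rounds the prover sends a message and the verifier
answers. The last message of the verifier is its verdict. -/
structure IdScheme where
  rounds : ℕ
  gen : Prog
  prover : Machine rounds
  verifier : Machine rounds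

section Interaction

variable {p : ℕ} [Fact p.Prime] {G₁ : Type*} {G₂ : Type*} [CommGroup G₁] [CommGroup G₂]
  [Fintype G₁] [Fintype G₂]

/-- `n` rounds of interaction of `P` (which speaks first) with `V`, from the states `sP`, `sV`,
where `m` is the last message received by `P`. The result is the final state of `V` and the last
message of `V`. -/
def interact (S : Setting G₁ G₂) : (n : ℕ) → Machine n → Machine n →
    Val p G₁ G₂ → Val p G₁ G₂ → Val p G₁ G₂ → PMF (Val p G₁ G₂ × Val p G₁ G₂)
  | 0, _, _, _, sV, m => PMF.pure (sV, m)
  | n + 1, P, V, sP, sV, m =>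
      ((P 0).eval S (.pair sP m)).bind fun a =>
      ((V 0).eval S (.pair sV a.snd)).bind fun b =>
      interact S n (Fin.tail P) (Fin.tail V) a.fst b.fst b.snd

/-- The state of the cheating verifier, starting with `s`, after `q` sessions with the prover `P`,
which starts each session with the state `sP` and with fresh random choices. -/
def sessions (S : Setting G₁ G₂) {n : ℕ} (P : Machine n) (sP : Val p G₁ G₂) :
    (q : ℕ) → (Fin q → Machine n) → Val p G₁ G₂ → PMF (Val p G₁ G₂)
  | 0, _, s => PMF.pure s
  | q + 1, B, s => (interact S n P (B 0) sP s .nil).bind fun r =>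
      sessions S P sP q (Fin.tail B) r.1

/-- The output of the cheating verifier on the public key `pk` after its `q` sessions with the
honest prover, whose private key is `sk`. -/
def IdScheme.learn (I : IdScheme) (S : Setting G₁ G₂) {q : ℕ} (B : CheatingVerifier I.rounds q)
    (sk pk : Val p G₁ G₂) : PMF (Val p G₁ G₂) :=
  (sessions S I.prover (.pair sk pk) q B.session pk).bind fun s => B.output.eval S s

/-- The verdict of the honest verifier on the public key `pk` after an interaction with the
machine `A` in the initial state `sA`. -/
def IdScheme.verdict (I : IdScheme) (S : Setting G₁ G₂) (A : Machine I.rounds)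
    (sA pk : Val p G₁ G₂) : PMF Bool :=
  (interact S I.rounds A I.verifier sA pk .nil).map fun r => r.2.truth

/-- Key generation on `α`, followed by one interaction of the honest parties. -/
def IdScheme.honestRun (I : IdScheme) (p : ℕ) [Fact p.Prime] (S : Setting G₁ G₂)
    (α : List Bool) : PMF Bool :=
  (I.gen.eval S (Val.ofBits α : Val p G₁ G₂)).bind fun k =>
    I.verdict S I.prover (.pair k.fst k.snd) k.snd

/-- Key generation on `α`, then an active attack by the cheating verifier `B` and the cheating
prover `A`: `B` learns `T` in `q` sessions with the honest prover, and `A` gets the public key and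
`T` and interacts with the honest verifier. -/
def IdScheme.attack (I : IdScheme) (p : ℕ) [Fact p.Prime] (S : Setting G₁ G₂) (α : List Bool)
    {q : ℕ} (B : CheatingVerifier I.rounds q) (A : Machine I.rounds) : PMF Bool :=
  (I.gen.eval S (Val.ofBits α : Val p G₁ G₂)).bind fun k =>
    (I.learn S B k.fst k.snd).bind fun T => I.verdict S A (.pair k.snd T) k.snd

/-- `I` is a `(t, q, ε)`-identification scheme. -/
structure IdScheme.IsSecure (I : IdScheme) (p : ℕ) [Fact p.Prime] (S : Setting G₁ G₂)
    (κ : Op → ℕ) (t : ℝ) (q : ℕ) (ε : ℝ) : Prop where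
  prover_time : (I.prover.time κ : ℝ) ≤ t
  verifier_time : (I.verifier.time κ : ℝ) ≤ t
  viability : ∀ α : List Bool, I.honestRun p S α true = 1
  security : ∀ (α : List Bool) (B : CheatingVerifier I.rounds q), (B.time κ : ℝ) ≤ t →
    ∀ A : Machine I.rounds, (A.time κ : ℝ) ≤ t → (I.attack p S α B A true).toReal < ε

open Classical in
/-- The success of the program `C` in inverting the pairing at uniform `g ∈ G₁` and `x ∈ G₂`. -/
def inversionRun (p : ℕ) [Fact p.Prime] (S : Setting G₁ G₂) (C : Prog) : PMF Bool :=
  (PMF.uniformOfFintype G₁).bind fun g => (PMF.uniformOfFintype G₂).bind fun x =>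
    (C.eval S (.pair (.g1 g) (.g2 x) : Val p G₁ G₂)).map fun v =>
      decide (∃ h : G₁, v = .g1 h ∧ S.e g h = x)

/-- The map `e` is `(t, ε)`-one-way. -/
def IsOneWayPairing (p : ℕ) [Fact p.Prime] (S : Setting G₁ G₂) (κ : Op → ℕ) (t ε : ℝ) : Prop :=
  ∀ C : Prog, (C.time κ : ℝ) ≤ t → (inversionRun p S C true).toReal < ε

end Interaction

/-! ## The protocol -/

namespace OneWayId

/-- Apply a binary operation to the results of two programs. -/
def bin (o : Op) (f g : Prog) : Prog := .seq (.fork f g) (.prim o)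

/-- `(f, g, h, k) ↦ e(f, g) · h ^ k`. -/
def pairPow (f g h k : Prog) : Prog := bin .mul2 (bin .pairing f g) (bin .pow2 h k)

/-- Key generation: random `P, Q ∈ G₁`, `y ∈ G₂`, `s ∈ ℤ_p^*`; the private key is `(Q, s)`, and
the public key is `(P, (y, v))` with `v = e(P, Q)⁻¹ · y ^ (-s)`. -/
def gen : Prog :=
  -- the random choices, arranged as `((P, Q), (y, s))`
  .seq (.fork (.fork (.prim .rand1) (.prim .rand1)) (.fork (.prim .rand2) (.prim .randUnitZ)))
    (let P : Prog := .seq .fst .fst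
     let Q : Prog := .seq .fst .snd
     let y : Prog := .seq .snd .fst
     let s : Prog := .seq .snd .snd
     let v : Prog := bin .mul2 (.seq (bin .pairing P Q) (.prim .inv2))
       (bin .pow2 y (.seq s (.prim .negZ)))
     .fork (.fork Q s) (.fork P (.fork y v)))

/-- Commitment: on `(((Q, s), (P, (y, v))), _)`, choose random `R ∈ G₁`, `r ∈ ℤ_p`, keep the state
`((Q, s), (R, r))`, send `x = e(P, R) · y ^ r`. -/
def commit : Prog :=
  -- the keys and the random choices, arranged as `(keys, (R, r))`
  .seq (.fork .fst (.fork (.prim .rand1) (.prim .randZ)))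
    (let P : Prog := .seq .fst (.seq .snd .fst)
     let y : Prog := .seq .fst (.seq .snd (.seq .snd .fst))
     let R : Prog := .seq .snd .fst
     let r : Prog := .seq .snd .snd
     .fork (.fork (.seq .fst .fst) .snd) (pairPow P R y r))

/-- Response: on `(((Q, s), (R, r)), m)`, send `(T, a) = (R · Q ^ m, r + m s)`. -/
def respond : Prog :=
  let Q : Prog := .seq .fst (.seq .fst .fst)
  let s : Prog := .seq .fst (.seq .fst .snd)
  let R : Prog := .seq .fst (.seq .snd .fst)
  let r : Prog := .seq .fst (.seq .snd .snd)
  let m : Prog := .snd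
  .fork .nil (.fork (bin .mul1 R (bin .pow1 Q m)) (bin .addZ r (bin .mulZ m s)))

/-- Challenge: on `(pk, x)`, choose random `m ∈ ℤ_p^*`, keep the state `(pk, (x, m))`, send `m`. -/
def challenge : Prog :=
  .seq (.fork .id (.prim .randUnitZ))
    (.fork (.fork (.seq .fst .fst) (.fork (.seq .fst .snd) .snd)) .snd)

/-- Verification: on `(((P, (y, v)), (x, m)), (T, a))`, accept if and only if
`e(P, T) · y ^ a · v ^ m = x`. -/
def verify : Prog :=
  let P : Prog := .seq .fst (.seq .fst .fst)
  let y : Prog := .seq .fst (.seq .fst (.seq .snd .fst))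
  let v : Prog := .seq .fst (.seq .fst (.seq .snd .snd))
  let x : Prog := .seq .fst (.seq .snd .fst)
  let m : Prog := .seq .fst (.seq .snd .snd)
  let T : Prog := .seq .snd .fst
  let a : Prog := .seq .snd .snd
  .fork .nil (bin .eq (bin .mul2 (pairPow P T y a) (bin .pow2 v m)) x)

/-- The identification scheme based on the pairing as a one-way function. -/
def scheme : IdScheme where
  rounds := 2
  gen := gen
  prover := ![commit, respond]
  verifier := ![challenge, verify]

end OneWayId

end

/-! An attacker with success probability `a ≥ ε` is turned into an inverter of the pairing at `(g,
x)`. The inverter hides its instance in a perfectly distributed key, `P = g ^ α` and `y = x · e(g,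
W)`, and picks `Q`, `s` itself. It thus knows a private key and can play the honest prover against
`B` (`lexp_randomized`, `trial_nil_add_attack`). With `N = ⌊1/ε⌋` it makes up to `N` trials until
the attack succeeds, then up to `N` rewindings to the commitment until a second challenge `m' ≠ m`
is answered. Dividing the two verification equations gives `e(P, T T'⁻¹ Q ^ (m' - m)) = y ^ d` with
`d = a' - a + (m - m') s`, where `a`, `a'` here denote the two scalar responses, and `d ≠ 0` yields
a preimage of `x` (`pairing_extracted`).

Why `d ≠ 0` is likely: for `P ≠ 1` a session can be described in terms of the public key alone
(`interact_honest_eq`), so `s` is still uniform on the units given everything the attacker sees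
(`lexp_key_eq`), and at most one value of `s` makes `d` vanish (`forkProb_mul_le`).

Why the success probability is a constant: if a commitment is answered with probability `f`, then
all rewindings after a success fail with probability at most `f (1 - f + 1/(p-1)) ^ N`. This is
about `1/(2(N+1))`, less than about `ε/2`, whatever `f` is (`acceptProb_le`). One trial followed by
rewinding therefore succeeds with probability at least a constant times `a`, and repeating trials
multiplies this by at least `1/(2a)` (`lexp_retry`, `inverter_success_bound`).

These error terms are small only if `ε > 100/p`. For smaller `ε` the time allowed is of order `p`,
and guessing preimages suffices (`bruteForce_success`). -/

open scoped ENNReal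

/-! ### Expectations under a probability distribution -/

namespace PMF

variable {α β γ : Type*}

/-- The expected value of a function with values in `ℝ≥0∞`. -/
noncomputable def lexp (d : PMF α) (φ : α → ℝ≥0∞) : ℝ≥0∞ := ∑' a, d a * φ a

theorem bind_apply_eq_lexp (d : PMF α) (k : α → PMF β) (b : β) :
    d.bind k b = d.lexp fun a => k a b := rfl

@[simp]
theorem lexp_pure (a : α) (φ : α → ℝ≥0∞) : (PMF.pure a).lexp φ = φ a := by
  classical
  rw [lexp, tsum_eq_single a]
  · simp
  · intro b hb
    simp [PMF.pure_apply, hb]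

@[simp]
theorem lexp_bind (d : PMF α) (k : α → PMF β) (φ : β → ℝ≥0∞) :
    (d.bind k).lexp φ = d.lexp fun a => (k a).lexp φ := by
  simp only [lexp, PMF.bind_apply, ← ENNReal.tsum_mul_right, ← ENNReal.tsum_mul_left]
  rw [ENNReal.tsum_comm]
  simp only [mul_assoc]

theorem map_apply_eq_lexp [DecidableEq β] (d : PMF α) (f : α → β) (b : β) :
    d.map f b = d.lexp fun a => if f a = b then 1 else 0 := by
  rw [PMF.map_apply, lexp]
  refine tsum_congr fun a => ?_
  by_cases h : f a = b
  · simp [h]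
  · simp [h, Ne.symm h]

theorem lexp_mono (d : PMF α) {φ ψ : α → ℝ≥0∞} (h : ∀ a, φ a ≤ ψ a) : d.lexp φ ≤ d.lexp ψ :=
  ENNReal.tsum_le_tsum fun a => mul_le_mul_right (h a) _

theorem lexp_mono_support (d : PMF α) {φ ψ : α → ℝ≥0∞} (h : ∀ a, d a ≠ 0 → φ a ≤ ψ a) :
    d.lexp φ ≤ d.lexp ψ := by
  refine ENNReal.tsum_le_tsum fun a => ?_
  by_cases ha : d a = 0
  · simp [ha]
  · exact mul_le_mul_right (h a ha) _

theorem lexp_add (d : PMF α) (φ ψ : α → ℝ≥0∞) :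
    (d.lexp fun a => φ a + ψ a) = d.lexp φ + d.lexp ψ := by
  simp only [lexp, mul_add, ENNReal.tsum_add]

theorem lexp_mul_left (d : PMF α) (c : ℝ≥0∞) (φ : α → ℝ≥0∞) :
    (d.lexp fun a => c * φ a) = c * d.lexp φ := by
  simp only [lexp, ← ENNReal.tsum_mul_left]
  exact tsum_congr fun a => by ring

theorem lexp_mul_right (d : PMF α) (c : ℝ≥0∞) (φ : α → ℝ≥0∞) :
    (d.lexp fun a => φ a * c) = d.lexp φ * c := by
  simp only [lexp, ← ENNReal.tsum_mul_right, mul_assoc]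

@[simp]
theorem lexp_const (d : PMF α) (c : ℝ≥0∞) : (d.lexp fun _ => c) = c := by
  simp [lexp, ENNReal.tsum_mul_right]

theorem lexp_comm (d : PMF α) (d' : PMF β) (φ : α → β → ℝ≥0∞) :
    (d.lexp fun a => d'.lexp (φ a)) = d'.lexp fun b => d.lexp fun a => φ a b := by
  simp only [lexp, ← ENNReal.tsum_mul_left]
  rw [ENNReal.tsum_comm]
  exact tsum_congr fun b => tsum_congr fun a => by ring

theorem lexp_le_one (d : PMF α) {φ : α → ℝ≥0∞} (h : ∀ a, φ a ≤ 1) : d.lexp φ ≤ 1 :=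
  (d.lexp_mono h).trans (by simp)

theorem apply_add_lexp_ne [DecidableEq α] (d : PMF α) (a : α) :
    d a + (d.lexp fun b => if b = a then 0 else 1) = 1 := by
  have h : d a = d.lexp fun b => if b = a then 1 else 0 := by
    rw [lexp, tsum_eq_single a]
    · simp
    · intro b hb
      simp [hb]
  rw [h, ← lexp_add, ← d.lexp_const 1]
  congr 1
  funext b
  by_cases hb : b = a <;> simp [hb]

section Uniform

variable [Fintype α] [Nonempty α] [Fintype β] [Nonempty β]

theorem lexp_uniform (φ : α → ℝ≥0∞) :
    (uniformOfFintype α).lexp φ = (∑ a, φ a) * (Fintype.card α : ℝ≥0∞)⁻¹ := by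
  rw [lexp, tsum_fintype, Finset.sum_mul]
  exact Finset.sum_congr rfl fun a _ => by rw [uniformOfFintype_apply, mul_comm]

theorem lexp_uniform_bijective {f : α → β} (hf : f.Bijective) (φ : β → ℝ≥0∞) :
    ((uniformOfFintype α).lexp fun a => φ (f a)) = (uniformOfFintype β).lexp φ := by
  rw [lexp_uniform, lexp_uniform, Fintype.card_of_bijective hf, hf.sum_comp φ]

theorem bind_uniform_bijective {f : α → β} (hf : f.Bijective) (k : β → PMF γ) :
    ((uniformOfFintype α).bind fun a => k (f a)) = (uniformOfFintype β).bind k := by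
  ext c
  exact lexp_uniform_bijective hf fun b => k b c

open Classical in
/-- A condition that holds for at most one element has small probability. -/
theorem lexp_uniform_subsingleton_le {s : α → Prop} (hs : ∀ a b, s a → s b → a = b) :
    ((uniformOfFintype α).lexp fun a => if s a then 1 else 0) ≤ (Fintype.card α : ℝ≥0∞)⁻¹ := by
  rw [lexp_uniform]
  refine mul_le_of_le_one_left' ?_
  rw [Finset.sum_boole]
  have h : (Finset.univ.filter s).card ≤ 1 :=
    Finset.card_le_one.2 fun a ha b hb => hs a b (by simpa using ha) (by simpa using hb)
  exact_mod_cast h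

end Uniform

end PMF

namespace Val

variable {p : ℕ} {G₁ G₂ : Type*}

@[simp] theorem fst_pair (a b : Val p G₁ G₂) : (pair a b).fst = a := rfl
@[simp] theorem snd_pair (a b : Val p G₁ G₂) : (pair a b).snd = b := rfl

theorem truth_eq_true_iff (v : Val p G₁ G₂) : v.truth = true ↔ v ≠ nil := by
  cases v <;> simp [truth]

@[simp] theorem truth_nil : (nil : Val p G₁ G₂).truth = false := rfl
@[simp] theorem truth_pair (a b : Val p G₁ G₂) : (pair a b).truth = true := rfl

@[simp] theorem truth_ofBool (b : Bool) : (ofBool b : Val p G₁ G₂).truth = b := by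
  cases b <;> rfl

end Val

/-! ### Repeated sampling until success -/

section Retry

variable {p : ℕ} {G₁ G₂ : Type*}

/-- Sample from `d` until the result is different from `nil`, but at most `n` times. -/
noncomputable def retry (d : PMF (Val p G₁ G₂)) : ℕ → PMF (Val p G₁ G₂)
  | 0 => PMF.pure .nil
  | n + 1 => (retry d n).bind fun r => if r.truth then PMF.pure r else d

theorem retry_apply_nil (d : PMF (Val p G₁ G₂)) (n : ℕ) : retry d n .nil = d .nil ^ n := by
  induction n with
  | zero => simp [retry]
  | succ n ih =>
    rw [retry, PMF.bind_apply, tsum_eq_single .nil]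
    · simp [ih, pow_succ]
    · intro r hr
      simp [(Val.truth_eq_true_iff r).2 hr, PMF.pure_apply, hr.symm]

/-- A first success after `i` failures has weight `d .nil ^ i * d r`, so successes keep their
relative weights. -/
theorem retry_apply_of_ne (d : PMF (Val p G₁ G₂)) (n : ℕ) {r : Val p G₁ G₂} (hr : r ≠ .nil) :
    retry d n r = (∑ i ∈ Finset.range n, d .nil ^ i) * d r := by
  classical
  induction n with
  | zero => simp [retry, PMF.pure_apply, hr]
  | succ n ih =>
    have h : ∀ w, retry d n w * (if w.truth then PMF.pure w else d : PMF _) r =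
        (if w = .nil then retry d n .nil * d r else 0) + if w = r then retry d n r else 0 := by
      intro w
      by_cases hw : w = .nil
      · subst hw
        simp [hr.symm]
      · by_cases hwr : w = r
        · subst hwr
          simp [hw, (Val.truth_eq_true_iff w).2 hw]
        · simp [hw, hwr, (Val.truth_eq_true_iff w).2 hw, PMF.pure_apply, Ne.symm hwr]
    rw [retry, PMF.bind_apply, tsum_congr h, ENNReal.tsum_add, tsum_ite_eq, tsum_ite_eq,
      retry_apply_nil, ih, Finset.sum_range_succ]
    ring

theorem retry_support {d : PMF (Val p G₁ G₂)} {n : ℕ} {r : Val p G₁ G₂} (h : retry d n r ≠ 0)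
    (hr : r ≠ .nil) : d r ≠ 0 := by
  rw [retry_apply_of_ne d n hr] at h
  exact right_ne_zero_of_mul h

theorem lexp_retry (d : PMF (Val p G₁ G₂)) (n : ℕ) {φ : Val p G₁ G₂ → ℝ≥0∞} (hφ : φ .nil = 0) :
    (retry d n).lexp φ = (∑ i ∈ Finset.range n, d .nil ^ i) * d.lexp φ := by
  rw [← PMF.lexp_mul_left]
  refine tsum_congr fun r => ?_
  by_cases hr : r = .nil
  · simp [hr, hφ]
  · rw [retry_apply_of_ne d n hr]
    ring

end Retry

/-! ### Instruction counts -/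

section Time

theorem cost_le_totalOpCost (κ : Op → ℕ) (o : Op) : κ o + 1 ≤ totalOpCost κ :=
  List.single_le_sum (by simp) _ (List.mem_map.2 ⟨o, by cases o <;> simp [Op.all], rfl⟩)

theorem one_le_totalOpCost (κ : Op → ℕ) : 1 ≤ totalOpCost κ :=
  (Nat.le_add_left 1 _).trans (cost_le_totalOpCost κ .coin)

/-- The running time is bounded by the number of instructions times the total cost of the basic
operations. -/
theorem Prog.time_le (κ : Op → ℕ) (f : Prog) : f.time κ ≤ f.time 0 * totalOpCost κ := by
  have h1 := one_le_totalOpCost κ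
  induction f with
  | id | nil | fst | snd => simpa [Prog.time] using h1
  | prim o => simpa [Prog.time] using cost_le_totalOpCost κ o
  | seq f g hf hg | fork f g hf hg =>
    simp only [Prog.time]
    nlinarith
  | cond c f g hc hf hg =>
    simp only [Prog.time]
    nlinarith
  | loop n f hf =>
    simp only [Prog.time]
    nlinarith [Nat.mul_le_mul_left n hf]

end Time

/-! ### Interactions compiled into single programs -/

section Combinators

variable {p : ℕ} [Fact p.Prime] {G₁ : Type*} {G₂ : Type*} [CommGroup G₁] [CommGroup G₂]
  [Fintype G₁] [Fintype G₂] (S : Setting G₁ G₂)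

/-- Run `f` on the input until the result is different from `nil`, but at most `n` times. -/
def Prog.retry (n : ℕ) (f : Prog) : Prog :=
  .seq (.fork .id .nil)
    (.seq (.loop n (.fork .fst (.cond .snd .snd (.seq .fst f)))) .snd)

theorem Prog.eval_id (v : Val p G₁ G₂) : Prog.id.eval S v = PMF.pure v := rfl

theorem Prog.eval_nil (v : Val p G₁ G₂) : Prog.nil.eval S v = PMF.pure .nil := rfl

theorem Prog.eval_snd (v : Val p G₁ G₂) : Prog.snd.eval S v = PMF.pure v.snd := rfl

theorem Prog.eval_seq (f g : Prog) (v : Val p G₁ G₂) :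
    (Prog.seq f g).eval S v = (f.eval S v).bind fun w => g.eval S w := rfl

theorem Prog.eval_fork (f g : Prog) (v : Val p G₁ G₂) :
    (Prog.fork f g).eval S v =
      (f.eval S v).bind fun a => (g.eval S v).bind fun b => PMF.pure (.pair a b) := rfl

theorem Prog.eval_loop_zero (f : Prog) (v : Val p G₁ G₂) :
    (Prog.loop 0 f).eval S v = PMF.pure v := rfl

theorem Prog.eval_loop_succ (n : ℕ) (f : Prog) (v : Val p G₁ G₂) :
    (Prog.loop (n + 1) f).eval S v = ((Prog.loop n f).eval S v).bind fun w => f.eval S w := rfl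

theorem Prog.eval_retry (n : ℕ) (f : Prog) (v : Val p G₁ G₂) :
    (Prog.retry n f).eval S v = _root_.retry (f.eval S v) n := by
  -- Loop invariant: the state is the input paired with the result so far, which later iterations
  -- copy once it is not `nil`.
  have h : (Prog.loop n (.fork .fst (.cond .snd .snd (.seq .fst f)))).eval S (.pair v .nil) =
      (_root_.retry (f.eval S v) n).bind fun r => PMF.pure (.pair v r) := by
    induction n with
    | zero => simp [Prog.eval_loop_zero, _root_.retry]
    | succ n ih =>
      rw [Prog.eval_loop_succ, ih, _root_.retry, PMF.bind_bind, PMF.bind_bind]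
      congr 1
      funext r
      cases hr : r.truth <;> simp [Prog.eval, hr]
  rw [Prog.retry, Prog.eval_seq]
  simp only [Prog.eval_fork, Prog.eval_id, Prog.eval_nil, PMF.pure_bind, Prog.eval_seq, h,
    PMF.bind_bind, Prog.eval_snd, Val.snd_pair, PMF.bind_pure]

theorem Prog.time_retry (κ : Op → ℕ) (n : ℕ) (f : Prog) :
    (Prog.retry n f).time κ = n * (f.time κ + 7) + 7 := by
  simp only [Prog.retry, Prog.time]
  ring

/-- `n` rounds of interaction of `P` with `V`, on `(sP, (sV, m))`; the result is the final value of
this triple. -/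
def interactProg : (n : ℕ) → Machine n → Machine n → Prog
  | 0, _, _ => .id
  | n + 1, P, V =>
    .seq (.fork (.seq (.fork .fst (.seq .snd .snd)) (P 0)) (.seq .snd .fst))
      (.seq (.fork (.seq .fst .fst) (.seq (.fork .snd (.seq .fst .snd)) (.seq (V 0) (.fork .fst .snd))))
        (interactProg n (Fin.tail P) (Fin.tail V)))

/-- The program still carries the prover's final state, which `interact` forgets; hence a
continuation that only sees `w.snd`. -/
theorem eval_interactProg_bind (n : ℕ) (P V : Machine n) (sP sV m : Val p G₁ G₂)
    (k : Val p G₁ G₂ → PMF (Val p G₁ G₂)) :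
    (((interactProg n P V).eval S (.pair sP (.pair sV m))).bind fun w => k w.snd) =
      (interact S n P V sP sV m).bind fun r => k (.pair r.1 r.2) := by
  induction n generalizing sP sV m with
  | zero => simp [interactProg, interact, Prog.eval]
  | succ n ih =>
    simp only [interactProg, interact, Prog.eval, PMF.bind_bind, PMF.pure_bind, Val.fst_pair,
      Val.snd_pair]
    congr 1
    funext a
    congr 1
    funext b
    exact ih ..

theorem time_interactProg (κ : Op → ℕ) (n : ℕ) (P V : Machine n) :
    (interactProg n P V).time κ = P.time κ + V.time κ + (26 * n + 1) := by
  induction n with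
  | zero => simp [interactProg, Prog.time, Machine.time]
  | succ n ih =>
    rw [interactProg]
    simp only [Prog.time, ih]
    simp only [Machine.time, Fin.sum_univ_succ, Fin.tail]
    ring

/-- The sessions of a cheating verifier with the prover `P`, on the pair of the initial states. -/
def sessionsProg {n : ℕ} (P : Machine n) : (q : ℕ) → (Fin q → Machine n) → Prog
  | 0, _ => .snd
  | q + 1, B =>
    .seq (.fork .fst (.seq (.seq (.seq (.fork .fst (.fork .snd .nil)) (interactProg n P (B 0)))
      .snd) .fst)) (sessionsProg P q (Fin.tail B))

theorem eval_sessionsProg {n : ℕ} (P : Machine n) (q : ℕ) (B : Fin q → Machine n)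
    (sP s : Val p G₁ G₂) :
    (sessionsProg P q B).eval S (.pair sP s) = sessions S P sP q B s := by
  induction q generalizing s with
  | zero => rfl
  | succ q ih =>
    simp only [sessionsProg, sessions, Prog.eval, PMF.bind_bind, PMF.pure_bind, Val.fst_pair,
      Val.snd_pair, ih]
    rw [eval_interactProg_bind S n P (B 0) sP s .nil fun w => sessions S P sP q (Fin.tail B) w.fst]
    rfl

theorem time_sessionsProg (κ : Op → ℕ) {n : ℕ} (P : Machine n) (q : ℕ) (B : Fin q → Machine n) :
    (sessionsProg P q B).time κ =
      ∑ j, (B j).time κ + q * (P.time κ + (26 * n + 14)) + 1 := by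
  induction q with
  | zero => simp [sessionsProg, Prog.time]
  | succ q ih =>
    rw [sessionsProg]
    simp only [Prog.time, ih, time_interactProg, Fin.sum_univ_succ, Fin.tail]
    ring

/-- What the cheating verifier learns, on the pair of the private and the public key. -/
def learnProg {n q : ℕ} (P : Machine n) (B : CheatingVerifier n q) : Prog :=
  .seq (.seq (.fork .id .snd) (sessionsProg P q B.session)) B.output

theorem eval_learnProg (I : IdScheme) {q : ℕ} (B : CheatingVerifier I.rounds q)
    (sk pk : Val p G₁ G₂) :
    (learnProg I.prover B).eval S (.pair sk pk) = I.learn S B sk pk := by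
  simp [learnProg, Prog.eval, IdScheme.learn, eval_sessionsProg]

theorem time_learnProg (κ : Op → ℕ) {n q : ℕ} (P : Machine n) (B : CheatingVerifier n q) :
    (learnProg P B).time κ = B.time κ + q * (P.time κ + (26 * n + 14)) + 6 := by
  simp only [learnProg, Prog.time, time_sessionsProg, CheatingVerifier.time]
  ring

end Combinators

/-! ### Exponents modulo `p` and pairings -/

section PowVal

variable {p : ℕ} [Fact p.Prime] {G : Type*} [CommGroup G]

/-- The module structure of a group of exponent `p`, written additively, over `ZMod p`. -/
abbrev zmodModuleAdditive (hG : ∀ x : G, x ^ p = 1) : Module (ZMod p) (Additive G) :=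
  AddCommGroup.zmodModule fun x => congrArg Additive.ofMul (hG x.toMul)

/-- Exponents become scalars, so identities between group elements become linear identities over
`ZMod p` within reach of `module`. -/
theorem ofMul_pow_val (hG : ∀ x : G, x ^ p = 1) (x : G) (z : ZMod p) :
    letI := zmodModuleAdditive hG
    Additive.ofMul (x ^ z.val) = z • Additive.ofMul x := by
  let := zmodModuleAdditive hG
  rw [ofMul_pow, ← Nat.cast_smul_eq_nsmul (ZMod p), ZMod.natCast_zmod_val]

theorem pow_val_bijective [Fintype G] (hG : Fintype.card G = p) {g : G} (hg : g ≠ 1) :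
    Function.Bijective fun z : ZMod p => g ^ z.val := by
  refine (Fintype.bijective_iff_surjective_and_card _).2 ⟨fun x => ?_, by rw [ZMod.card, hG]⟩
  obtain ⟨k, rfl⟩ := mem_zpowers_of_prime_card (p := p) (by rw [Nat.card_eq_fintype_card, hG]) hg
    (g' := x)
  have hk : ∀ x : G, x ^ p = 1 := fun x => hG ▸ pow_card_eq_one
  refine ⟨(k : ZMod p), ?_⟩
  have h := ZMod.val_intCast (n := p) k
  simp only
  rw [← zpow_natCast, h, ← zpow_eq_zpow_emod' k (hk g)]

end PowVal

section Pairing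

variable {p : ℕ} [Fact p.Prime] {G₁ : Type*} {G₂ : Type*} [CommGroup G₁] [CommGroup G₂]
  {e : G₁ → G₁ → G₂}

theorem IsCryptographicPairing.map_mul_right (he : IsCryptographicPairing e) (hc : IsCyclic G₁)
    (x y z : G₁) : e x (y * z) = e x y * e x z := by
  obtain ⟨g, hg⟩ := hc.exists_generator
  obtain ⟨a, rfl⟩ := hg x
  obtain ⟨b, rfl⟩ := hg y
  obtain ⟨c, rfl⟩ := hg z
  simp only [← zpow_add, he.bilinear, mul_add]

theorem IsCryptographicPairing.pow_left (he : IsCryptographicPairing e) (x y : G₁) (n : ℕ) :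
    e (x ^ n) y = e x y ^ n := by
  simpa using he.bilinear x y n 1

theorem IsCryptographicPairing.pow_right (he : IsCryptographicPairing e) (x y : G₁) (n : ℕ) :
    e x (y ^ n) = e x y ^ n := by
  simpa using he.bilinear x y 1 n

theorem IsCryptographicPairing.inv_right (he : IsCryptographicPairing e) (x y : G₁) :
    e x y⁻¹ = (e x y)⁻¹ := by
  simpa using he.bilinear x y 1 (-1)

/-- In prime order `x ≠ 1` is a generator, so `e x x` generates `G₂`; equal cardinalities turn
surjectivity into bijectivity. -/
theorem IsCryptographicPairing.right_bijective [Fintype G₁] [Fintype G₂]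
    (he : IsCryptographicPairing e) (h₁ : Fintype.card G₁ = p) (h₂ : Fintype.card G₂ = p) {x : G₁} (hx : x ≠ 1) :
    Function.Bijective (e x) := by
  refine (Fintype.bijective_iff_surjective_and_card _).2 ⟨fun z => ?_, by rw [h₁, h₂]⟩
  obtain ⟨k, hk⟩ := he.nondegenerate x (fun y => mem_zpowers_of_prime_card (p := p)
    (by rw [Nat.card_eq_fintype_card, h₁]) hx) z
  exact ⟨x ^ k, by simpa using (he.bilinear x x 1 k).trans (by simpa using hk)⟩

end Pairing

/-! ### The honest protocol and witness indistinguishability -/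

namespace OneWayId

/-- The third component of the public key. -/
def keyImage (p : ℕ) {G₁ G₂ : Type*} [CommGroup G₁] [CommGroup G₂] (S : Setting G₁ G₂)
    (P Q : G₁) (y : G₂) (s : ZMod p) : G₂ :=
  (S.e P Q)⁻¹ * y ^ (-s).val

theorem accepts_honest {p : ℕ} [Fact p.Prime] {G₁ G₂ : Type*} [CommGroup G₁]
    [CommGroup G₂] [Fintype G₂] {S : Setting G₁ G₂} (hc : IsCyclic G₁) (h₂ : Fintype.card G₂ = p)
    (he : IsCryptographicPairing S.e) (P Q R : G₁) (y : G₂) (s r m : ZMod p) :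
    S.e P (R * Q ^ m.val) * y ^ (r + m * s).val * keyImage p S P Q y s ^ m.val =
      S.e P R * y ^ r.val := by
  have hG : ∀ x : G₂, x ^ p = 1 := fun x => h₂ ▸ pow_card_eq_one
  let := zmodModuleAdditive hG
  apply Additive.ofMul.injective
  simp only [keyImage, he.map_mul_right hc, he.pow_right, ofMul_mul, ofMul_pow_val hG, ofMul_inv]
  module

variable {p : ℕ} [Fact p.Prime] {G₁ : Type*} {G₂ : Type*} [CommGroup G₁] [CommGroup G₂]
  [Fintype G₁] [Fintype G₂] (S : Setting G₁ G₂)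

/-- The private key as a value. -/
def privateKey (Q : G₁) (s : ZMod p) : Val p G₁ G₂ := .pair (.g1 Q) (.zp s)

/-- The public key as a value. -/
def publicKey (P : G₁) (y v : G₂) : Val p G₁ G₂ := .pair (.g1 P) (.pair (.g2 y) (.g2 v))

theorem eval_gen (w : Val p G₁ G₂) :
    gen.eval S w =
      (PMF.uniformOfFintype G₁).bind fun P => (PMF.uniformOfFintype G₁).bind fun Q =>
      (PMF.uniformOfFintype G₂).bind fun y => (PMF.uniformOfFintype (ZMod p)ˣ).bind fun s =>
      PMF.pure (.pair (privateKey Q s) (publicKey P y (keyImage p S P Q y s))) := by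
  simp [gen, bin, Prog.eval, Op.eval, PMF.bind_map, PMF.monad_map_eq_map, privateKey, publicKey, keyImage,
    Function.comp_def]

theorem eval_commit (P Q : G₁) (y v : G₂) (s : ZMod p) (m : Val p G₁ G₂) :
    commit.eval S (.pair (.pair (privateKey Q s) (publicKey P y v)) m) =
      (PMF.uniformOfFintype G₁).bind fun R => (PMF.uniformOfFintype (ZMod p)).bind fun r =>
      PMF.pure (.pair (.pair (privateKey Q s) (.pair (.g1 R) (.zp r)))
        (.g2 (S.e P R * y ^ r.val))) := by
  simp [commit, pairPow, bin, Prog.eval, Op.eval, PMF.bind_map, privateKey, publicKey,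
    Function.comp_def]

/-- `(T, a)` if the challenge is an element of `ZMod p`. -/
def answer (T : ZMod p → G₁) (a : ZMod p → ZMod p) : Val p G₁ G₂ → Val p G₁ G₂
  | .zp m => .pair .nil (.pair (.g1 (T m)) (.zp (a m)))
  | _ => .pair .nil (.pair .nil .nil)

theorem eval_respond (Q R : G₁) (s r : ZMod p) (m : Val p G₁ G₂) :
    respond.eval S (.pair (.pair (privateKey Q s) (.pair (.g1 R) (.zp r))) m) =
      PMF.pure (answer (fun m => R * Q ^ m.val) (fun m => r + m * s) m) := by
  cases m <;> simp [respond, bin, Prog.eval, Op.eval, privateKey, answer]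

theorem eval_challenge (pk x : Val p G₁ G₂) :
    challenge.eval S (.pair pk x) = (PMF.uniformOfFintype (ZMod p)ˣ).bind fun m =>
      PMF.pure (.pair (.pair pk (.pair x (.zp m))) (.zp m)) := by
  simp [challenge, Prog.eval, Op.eval, PMF.bind_map, PMF.monad_map_eq_map, Function.comp_def]

/-- The transcript `(x, m, c)` is accepted. -/
def Accepts (P : G₁) (y v : G₂) (x : Val p G₁ G₂) (m : ZMod p) (c : Val p G₁ G₂) : Prop :=
  ∃ (T : G₁) (a : ZMod p), c.fst = .g1 T ∧ c.snd = .zp a ∧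
    x = .g2 (S.e P T * y ^ a.val * v ^ m.val)

open Classical in
theorem eval_verify (P : G₁) (y v : G₂) (x : Val p G₁ G₂) (m : ZMod p) (c : Val p G₁ G₂) :
    verify.eval S (.pair (.pair (publicKey P y v) (.pair x (.zp m))) c) =
      PMF.pure (.pair .nil (.ofBool (decide (Accepts S P y v x m c)))) := by
  simp only [verify, pairPow, bin, Prog.eval, Op.eval, PMF.pure_bind, Val.fst_pair, Val.snd_pair,
    publicKey]
  cases h1 : c.fst <;> cases h2 : c.snd <;> cases x <;>
    simp [Accepts, h1, h2, Val.ofBool, eq_comm]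

theorem interact_two (A B : Machine 2) (sA sB m : Val p G₁ G₂) :
    interact S 2 A B sA sB m =
      ((A 0).eval S (.pair sA m)).bind fun a => ((B 0).eval S (.pair sB a.snd)).bind fun b =>
      ((A 1).eval S (.pair a.fst b.snd)).bind fun c =>
      ((B 1).eval S (.pair b.fst c.snd)).bind fun d => PMF.pure (d.fst, d.snd) := rfl

theorem eval_honestRun {S : Setting G₁ G₂} (hc : IsCyclic G₁) (h₂ : Fintype.card G₂ = p)
    (he : IsCryptographicPairing S.e) (α : List Bool) :
    scheme.honestRun p S α true = 1 := by
  classical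
  have h : scheme.honestRun p S α = PMF.pure true := by
    have hv : ∀ P Q : G₁, ∀ y : G₂, ∀ s : ZMod p, scheme.verdict S scheme.prover
        (.pair (privateKey Q s) (publicKey P y (keyImage p S P Q y s)))
        (publicKey P y (keyImage p S P Q y s)) = PMF.pure true := by
      intro P Q y s
      have hA : ∀ R r m, Accepts S P y (keyImage p S P Q y s) (.g2 (S.e P R * y ^ r.val)) m
          (.pair (.g1 (R * Q ^ m.val)) (.zp (r + m * s)) : Val p G₁ G₂) :=
        fun R r m => ⟨_, _, rfl, rfl, by rw [accepts_honest hc h₂ he]⟩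
      rw [IdScheme.verdict]
      change PMF.map _ (interact S 2 ![commit, respond] ![challenge, verify] _ _ _) = _
      simp [interact_two, eval_commit, eval_challenge, eval_respond, answer, eval_verify, hA,
        PMF.pure_map]
    simp only [IdScheme.honestRun]
    change PMF.bind (gen.eval S _) _ = _
    simp [eval_gen, hv]
  rw [h, PMF.pure_apply, if_pos rfl]

/-- For a public key with `P ≠ 1`, a session with the honest prover can be simulated without the
private key by anyone who can invert the pairing. -/
theorem interact_honest_eq {S : Setting G₁ G₂} (hc : IsCyclic G₁) (h₁ : Fintype.card G₁ = p)
    (h₂ : Fintype.card G₂ = p)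
    (he : IsCryptographicPairing S.e) {P : G₁} (hP : P ≠ 1) {F : G₂ → G₁}
    (hF : ∀ x, S.e P (F x) = x) (Q : G₁) (y : G₂) (s : ZMod p) (B : Machine 2)
    (sB m₀ : Val p G₁ G₂) :
    interact S 2 ![commit, respond] B
        (.pair (privateKey Q s) (publicKey P y (keyImage p S P Q y s))) sB m₀ =
      (PMF.uniformOfFintype G₂).bind fun x => ((B 0).eval S (.pair sB (.g2 x))).bind fun b =>
      (PMF.uniformOfFintype (ZMod p)).bind fun a =>
      ((B 1).eval S (.pair b.fst
        (answer (fun m => F (x * (y ^ a.val)⁻¹ * (keyImage p S P Q y s ^ m.val)⁻¹)) (fun _ => a)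
          b.snd).snd)).bind fun d => PMF.pure (d.fst, d.snd) := by
  have hG : ∀ x : G₂, x ^ p = 1 := fun x => h₂ ▸ pow_card_eq_one
  have hbij := he.right_bijective h₁ h₂ hP
  -- The response `T` is the only element that satisfies the verification equation, hence a function
  -- of `x`, `a`, `m` and the public key.
  have key : ∀ (x : G₂) (r m : ZMod p), F (x * (y ^ r.val)⁻¹) * Q ^ m.val =
      F (x * (y ^ (r + m * s).val)⁻¹ * (keyImage p S P Q y s ^ m.val)⁻¹) := by
    intro x r m
    apply hbij.1
    let := zmodModuleAdditive hG
    apply Additive.ofMul.injective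
    simp only [keyImage, he.map_mul_right hc, he.pow_right, hF, ofMul_mul, ofMul_pow_val hG,
      ofMul_inv]
    module
  rw [interact_two]
  simp only [Matrix.cons_val_zero, Matrix.cons_val_one, eval_commit, PMF.bind_bind, PMF.pure_bind,
    Val.fst_pair, Val.snd_pair, eval_respond]
  -- For fixed `r` the commitment is uniform as `R` varies. Once `R` is traded for `x`, the choice
  -- of `r` can be postponed past the challenge, and the shift by `m * s` makes `a` uniform.
  rw [PMF.bind_comm]
  have hswap : ∀ r : ZMod p, ∀ k : G₁ → G₂ → PMF (Val p G₁ G₂ × Val p G₁ G₂),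
      ((PMF.uniformOfFintype G₁).bind fun R => k R (S.e P R * y ^ r.val)) =
      (PMF.uniformOfFintype G₂).bind fun x => k (F (x * (y ^ r.val)⁻¹)) x := by
    intro r k
    have h : Function.Bijective fun R => S.e P R * y ^ r.val :=
      (Group.mulRight_bijective _).comp hbij
    rw [← PMF.bind_uniform_bijective h]
    congr 1
    funext R
    congr 1
    apply hbij.1
    rw [hF, mul_inv_cancel_right]
  refine (congrArg _ (funext fun r => hswap r fun R x => ((B 0).eval S (.pair sB (.g2 x))).bind
    fun b => ((B 1).eval S (.pair b.fst (answer (fun m => R * Q ^ m.val) (fun m => r + m * s)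
      b.snd).snd)).bind fun d => PMF.pure (d.fst, d.snd))).trans ?_
  rw [PMF.bind_comm]
  congr 1
  funext x
  rw [PMF.bind_comm]
  congr 1
  funext b
  cases b.snd with
  | zp m =>
    simp only [answer, key]
    exact PMF.bind_uniform_bijective (AddGroup.addRight_bijective (m * s)) fun a =>
      ((B 1).eval S (.pair b.fst (.pair (.g1 (F (x * (y ^ a.val)⁻¹ *
        (keyImage p S P Q y s ^ m.val)⁻¹))) (.zp a)))).bind fun d => PMF.pure (d.fst, d.snd)
  | _ => simp [answer]

/-- The protocol is witness indistinguishable. -/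
theorem learn_eq_of_keyImage_eq {S : Setting G₁ G₂} (hc : IsCyclic G₁)
    (h₁ : Fintype.card G₁ = p) (h₂ : Fintype.card G₂ = p) (he : IsCryptographicPairing S.e)
    {P : G₁} (hP : P ≠ 1) {Q Q' : G₁} {y : G₂} {s s' : ZMod p}
    (h : keyImage p S P Q y s = keyImage p S P Q' y s') {q : ℕ}
    (B : CheatingVerifier scheme.rounds q) :
    scheme.learn S B (privateKey Q s) (publicKey P y (keyImage p S P Q y s)) =
      scheme.learn S B (privateKey Q' s') (publicKey P y (keyImage p S P Q y s)) := by
  obtain ⟨F, hF⟩ := (he.right_bijective h₁ h₂ hP).2.hasRightInverse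
  have hs : ∀ (q : ℕ) (B : Fin q → Machine 2) (sB : Val p G₁ G₂),
      sessions S ![commit, respond]
        (.pair (privateKey Q s) (publicKey P y (keyImage p S P Q y s))) q B sB =
      sessions S ![commit, respond]
        (.pair (privateKey Q' s') (publicKey P y (keyImage p S P Q y s))) q B sB := by
    intro q
    induction q with
    | zero => intros; rfl
    | succ q ih =>
      intro B sB
      have hi : interact S 2 ![commit, respond] (B 0)
            (.pair (privateKey Q s) (publicKey P y (keyImage p S P Q y s))) sB .nil =
          interact S 2 ![commit, respond] (B 0)
            (.pair (privateKey Q' s') (publicKey P y (keyImage p S P Q y s))) sB .nil := by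
        -- Both sides become the same simulation, which refers to the private key only through
        -- `keyImage`.
        rw [interact_honest_eq hc h₁ h₂ he hP hF, h, interact_honest_eq hc h₁ h₂ he hP hF]
      simp only [sessions, hi, ih]
  exact congrArg (fun d => d.bind fun s => B.output.eval S s) (hs q B.session _)

end OneWayId

/-! ### The inverter and the extraction identity -/

namespace OneWayId

/-- On `((P, Q), (y, s))`, compute the pair of the private and the public key. -/
def publish : Prog :=
  .fork (.fork (.seq .fst .snd) (.seq .snd .snd)) (.fork (.seq .fst .fst) (.fork (.seq .snd .fst)
    (bin .mul2 (.seq (bin .pairing (.seq .fst .fst) (.seq .fst .snd)) (.prim .inv2))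
      (bin .pow2 (.seq .snd .fst) (.seq (.seq .snd .snd) (.prim .negZ))))))

/-- On `(g, x)`, choose random `α ∈ ℤ_p`, `W, Q ∈ G₁`, `s ∈ ℤ_p^*`, and return `(α, W)` with the
keys that belong to `P = g ^ α`, `Q`, `y = x · e(g, W)`, `s`. -/
def randomizedKeys : Prog :=
  .seq (.fork .id (.fork (.fork (.prim .randZ) (.prim .rand1))
      (.fork (.prim .rand1) (.prim .randUnitZ))))
    (let g : Prog := .seq .fst .fst
     let x : Prog := .seq .fst .snd
     let α : Prog := .seq .snd (.seq .fst .fst)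
     let W : Prog := .seq .snd (.seq .fst .snd)
     .fork (.seq .snd .fst)
      (.seq (.fork (.fork (bin .pow1 g α) (.seq .snd (.seq .snd .fst)))
        (.fork (bin .mul2 x (bin .pairing g W)) (.seq .snd (.seq .snd .snd)))) publish))

/-- On `((_, (sk, pk)), (σ, x))`, where `x` is the commitment of the cheating prover and `σ` its
state, give it a random challenge `m` and compute its response `c`. The result is `(m, c)` if the
verifier accepts, and `nil` otherwise. -/
def attempt (A₁ : Prog) : Prog :=
  .seq (.fork (.seq .snd .fst)
      (.seq (.fork (.seq .fst (.seq .snd .snd)) (.seq .snd .snd)) challenge))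
    (.seq (.fork (.seq .snd .fst) (.seq (.seq (.fork .fst (.seq .snd .snd)) A₁) .snd))
      (.cond (.seq verify .snd) (.fork (.seq .fst (.seq .snd .snd)) .snd) .nil))

/-- On `(g, x)`, run the whole attack on the randomized keys. The result is `nil` if it fails, and
otherwise it consists of all the data needed to continue the attack from the commitment, and the
accepted `(m, c)`. -/
def trial {q : ℕ} (B : CheatingVerifier scheme.rounds q) (A : Machine scheme.rounds) : Prog :=
  .seq randomizedKeys
    (.seq (.fork .id (.seq (.fork (.fork (.seq .snd .snd) (.seq .snd (learnProg scheme.prover B)))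
        .nil) (A (0 : Fin 2))))
      (.seq (.fork .id (attempt (A (1 : Fin 2)))) (.cond .snd .id .nil)))

/-- After a successful trial, attempt to get another accepted pair with a different challenge. -/
def rewind (A₁ : Prog) : Prog :=
  .seq (.fork .id (.seq .fst (attempt A₁)))
    (.cond (bin .eq (.seq .snd .fst) (.seq .fst (.seq .snd .fst))) .nil .snd)

/-- Compute a preimage from the data of a successful trial and a second accepted pair. -/
def extract : Prog :=
  let aux : Prog := .seq .fst (.seq .fst (.seq .fst .fst))
  let sk : Prog := .seq .fst (.seq .fst (.seq .fst (.seq .snd .fst)))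
  let c : Prog := .seq .fst .snd
  let c' : Prog := .snd
  let m : Prog := .seq c .fst
  let m' : Prog := .seq c' .fst
  let d : Prog := bin .addZ
    (bin .addZ (.seq c' (.seq .snd .snd)) (.seq (.seq c (.seq .snd .snd)) (.prim .negZ)))
    (bin .mulZ (bin .addZ m (.seq m' (.prim .negZ))) (.seq sk .snd))
  bin .mul1
    (bin .pow1
      (bin .mul1
        (bin .mul1 (.seq c (.seq .snd .fst)) (.seq (.seq c' (.seq .snd .fst)) (.prim .inv1)))
        (bin .pow1 (.seq sk .fst) (bin .addZ m' (.seq m (.prim .negZ)))))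
      (bin .mulZ (.seq aux .fst) (.seq d (.prim .invZ))))
    (.seq (.seq aux .snd) (.prim .inv1))

/-- The algorithm that inverts the pairing, with at most `N` trials and `N` rewindings. -/
def inverter (N : ℕ) {q : ℕ} (B : CheatingVerifier scheme.rounds q)
    (A : Machine scheme.rounds) : Prog :=
  .seq (.retry N (trial B A)) (.seq (.fork .id (.retry N (rewind (A (1 : Fin 2))))) extract)

section Semantics

variable {p : ℕ} [Fact p.Prime] {G₁ : Type*} {G₂ : Type*} [CommGroup G₁] [CommGroup G₂]
  [Fintype G₁] [Fintype G₂] (S : Setting G₁ G₂)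

theorem eval_randomizedKeys (g : G₁) (x : G₂) :
    randomizedKeys.eval S (.pair (.g1 g) (.g2 x)) =
      (PMF.uniformOfFintype (ZMod p)).bind fun α => (PMF.uniformOfFintype G₁).bind fun W =>
      (PMF.uniformOfFintype G₁).bind fun Q => (PMF.uniformOfFintype (ZMod p)ˣ).bind fun s =>
      PMF.pure (.pair (.pair (.zp α) (.g1 W)) (.pair (privateKey Q s)
        (publicKey (g ^ α.val) (x * S.e g W)
          (keyImage p S (g ^ α.val) Q (x * S.e g W) s)))) := by
  simp [randomizedKeys, publish, bin, Prog.eval, Op.eval, PMF.bind_map, PMF.monad_map_eq_map,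
    privateKey, publicKey, keyImage, Function.comp_def]

open Classical in
/-- The distribution of the result of an attempt. -/
noncomputable def attemptDist (A₁ : Prog) (P : G₁) (y v : G₂) (σ x : Val p G₁ G₂) : PMF (Val p G₁ G₂) :=
  (PMF.uniformOfFintype (ZMod p)ˣ).bind fun m => (A₁.eval S (.pair σ (.zp m))).bind fun c =>
    PMF.pure (if Accepts S P y v x m c.snd then .pair (.zp m) c.snd else .nil)

theorem eval_attempt (A₁ : Prog) (P : G₁) (y v : G₂) (aux sk a : Val p G₁ G₂) :
    (attempt A₁).eval S (.pair (.pair aux (.pair sk (publicKey P y v))) a) =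
      attemptDist S A₁ P y v a.fst a.snd := by
  simp only [attempt, attemptDist, Prog.eval, PMF.bind_bind, PMF.pure_bind, Val.fst_pair,
    Val.snd_pair, eval_challenge, eval_verify, Val.truth_ofBool, decide_eq_true_eq]
  congr 1
  funext m
  congr 1
  funext c
  by_cases h : Accepts S P y v a.snd m c.snd
  · rw [if_pos h]
    exact if_pos (by simp [h])
  · rw [if_neg h]
    exact if_neg (by simp [h])

open Classical in
/-- The distribution of the result of a rewinding after an accepted pair with the challenge `m`. -/
noncomputable def rewindDist (A₁ : Prog) (P : G₁) (y v : G₂) (σ x m : Val p G₁ G₂) : PMF (Val p G₁ G₂) :=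
  (attemptDist S A₁ P y v σ x).bind fun r => PMF.pure (if r.fst = m then .nil else r)

theorem eval_rewind (A₁ : Prog) (P : G₁) (y v : G₂) (aux sk a r : Val p G₁ G₂) {m : ZMod p}
    (hr : r.fst = .zp m) :
    (rewind A₁).eval S (.pair (.pair (.pair aux (.pair sk (publicKey P y v))) a) r) =
      rewindDist S A₁ P y v a.fst a.snd r.fst := by
  simp only [rewind, rewindDist, bin, Prog.eval, Op.eval, PMF.bind_bind, PMF.pure_bind,
    Val.fst_pair, Val.snd_pair, eval_attempt, hr]
  congr 1
  funext r'
  -- On values of different sorts the equality test returns `nil`, which counts as different, as it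
  -- should.
  cases r'.fst with
  | zp m' => by_cases h : m' = m <;> simp [h, hr]
  | _ => simp [hr]

theorem eval_trial {q : ℕ} (B : CheatingVerifier scheme.rounds q) (A : Machine scheme.rounds)
    (g : G₁) (x : G₂) :
    (trial B A).eval S (.pair (.g1 g) (.g2 x)) =
      (PMF.uniformOfFintype (ZMod p)).bind fun α => (PMF.uniformOfFintype G₁).bind fun W =>
      (PMF.uniformOfFintype G₁).bind fun Q => (PMF.uniformOfFintype (ZMod p)ˣ).bind fun s =>
      let P := g ^ α.val
      let y := x * S.e g W
      let v := keyImage p S P Q y s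
      (scheme.learn S B (privateKey Q s) (publicKey P y v)).bind fun T =>
      ((A (0 : Fin 2)).eval S (.pair (.pair (publicKey P y v) T) .nil)).bind fun a =>
      (attemptDist S (A (1 : Fin 2)) P y v a.fst a.snd).bind fun r =>
      PMF.pure (if r.truth then .pair (.pair (.pair (.pair (.zp α) (.g1 W))
        (.pair (privateKey Q s) (publicKey P y v))) a) r else .nil) := by
  simp only [trial, Prog.eval, PMF.bind_bind, PMF.pure_bind, Val.snd_pair,
    eval_randomizedKeys, eval_attempt, eval_learnProg]
  repeat (congr 1; funext r)
  by_cases h : r.truth = true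
  · rw [if_pos h]
    exact if_pos h
  · rw [if_neg h]
    exact if_neg h

theorem eval_extract (α s m m' a a' : ZMod p) (W Q T T' : G₁) (pk b c c' : Val p G₁ G₂)
    (hT : c.fst = .g1 T) (ha : c.snd = .zp a) (hT' : c'.fst = .g1 T') (ha' : c'.snd = .zp a') :
    extract.eval S (.pair (.pair (.pair (.pair (.pair (.zp α) (.g1 W)) (.pair (privateKey Q s) pk))
        b) (.pair (.zp m) c)) (.pair (.zp m') c')) =
      PMF.pure (.g1 ((T * T'⁻¹ * Q ^ (m' + -m).val) ^
        (α * (a' + -a + (m + -m') * s)⁻¹).val * W⁻¹)) := by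
  simp [extract, bin, Prog.eval, Op.eval, privateKey, hT, ha, hT', ha']

end Semantics

/-- Substituting the definition of `keyImage` and dividing gives `e(P, T T'⁻¹ Q ^ (m' - m)) = y ^
d`. Since `P = g ^ α` and `y = x · e(g, W)`, raising to `d⁻¹` and removing `W` leaves `x`. -/
theorem pairing_extracted {p : ℕ} [Fact p.Prime] {G₁ G₂ : Type*} [CommGroup G₁] [CommGroup G₂]
    [Fintype G₂] {S : Setting G₁ G₂} (hc : IsCyclic G₁) (h₂ : Fintype.card G₂ = p)
    (he : IsCryptographicPairing S.e) {g W Q T T' : G₁} {x : G₂} {α s m m' a a' : ZMod p}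
    (hd : a' + -a + (m + -m') * s ≠ 0)
    (h : S.e (g ^ α.val) T * (x * S.e g W) ^ a.val *
        keyImage p S (g ^ α.val) Q (x * S.e g W) s ^ m.val =
      S.e (g ^ α.val) T' * (x * S.e g W) ^ a'.val *
        keyImage p S (g ^ α.val) Q (x * S.e g W) s ^ m'.val) :
    S.e g ((T * T'⁻¹ * Q ^ (m' + -m).val) ^ (α * (a' + -a + (m + -m') * s)⁻¹).val * W⁻¹) = x := by
  have hG : ∀ x : G₂, x ^ p = 1 := fun x => h₂ ▸ pow_card_eq_one
  let := zmodModuleAdditive hG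
  apply Additive.ofMul.injective
  replace h := congrArg Additive.ofMul h
  simp only [keyImage, he.map_mul_right hc, he.pow_right, he.pow_left, he.inv_right, ofMul_mul,
    ofMul_pow_val hG, ofMul_inv] at h ⊢
  set d := a' + -a + (m + -m') * s with hd'
  have key : α • Additive.ofMul (S.e g T) + -(α • Additive.ofMul (S.e g T')) +
      (m' + -m) • α • Additive.ofMul (S.e g Q) =
      d • (Additive.ofMul x + Additive.ofMul (S.e g W)) := by
    rw [hd']
    linear_combination (norm := module) h
  have key' := congrArg (d⁻¹ • ·) key
  simp only [smul_smul, inv_mul_cancel₀ hd, one_smul] at key'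
  linear_combination (norm := module) key'

end OneWayId

/-! ### Forking probabilities and the hidden `s` -/

namespace OneWayId

variable {p : ℕ} [Fact p.Prime] {G₁ : Type*} {G₂ : Type*} [CommGroup G₁] [CommGroup G₂]
  [Fintype G₁] [Fintype G₂] (S : Setting G₁ G₂)

theorem attemptDist_support {A₁ : Prog} {P : G₁} {y v : G₂} {σ x r : Val p G₁ G₂}
    (h : attemptDist S A₁ P y v σ x r ≠ 0) (hr : r ≠ .nil) :
    ∃ (m : ZMod p) (c : Val p G₁ G₂), r = .pair (.zp m) c ∧ Accepts S P y v x m c := by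
  classical
  rw [← PMF.mem_support_iff, attemptDist, PMF.mem_support_bind_iff] at h
  obtain ⟨m, -, h⟩ := h
  rw [PMF.mem_support_bind_iff] at h
  obtain ⟨c, -, h⟩ := h
  rw [PMF.mem_support_pure_iff] at h
  split_ifs at h with hA
  · exact ⟨_, _, h, hA⟩
  · exact absurd h hr

theorem rewindDist_support {A₁ : Prog} {P : G₁} {y v : G₂} {σ x m r : Val p G₁ G₂}
    (h : rewindDist S A₁ P y v σ x m r ≠ 0) (hr : r ≠ .nil) :
    attemptDist S A₁ P y v σ x r ≠ 0 ∧ r.fst ≠ m := by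
  classical
  rw [← PMF.mem_support_iff, rewindDist, PMF.mem_support_bind_iff] at h
  obtain ⟨r', h', h⟩ := h
  rw [PMF.mem_support_pure_iff] at h
  split_ifs at h with hm
  · exact absurd h hr
  · subst h
    exact ⟨h', hm⟩

/-- A rewinding fails only if its attempt fails or its challenge repeats `m`. -/
theorem rewindDist_nil_le (A₁ : Prog) (P : G₁) (y v : G₂) (σ x m : Val p G₁ G₂) :
    rewindDist S A₁ P y v σ x m .nil ≤
      attemptDist S A₁ P y v σ x .nil + (Fintype.card (ZMod p)ˣ : ℝ≥0∞)⁻¹ := by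
  classical
  refine le_trans ?_ (add_le_add_right (PMF.lexp_uniform_subsingleton_le (α := (ZMod p)ˣ)
    (s := fun u => Val.zp (u : ZMod p) = m) ?_) _)
  · simp only [rewindDist, attemptDist, PMF.bind_bind, PMF.pure_bind, PMF.bind_apply_eq_lexp,
      ← PMF.lexp_add]
    refine PMF.lexp_mono _ fun u => ?_
    by_cases hm : Val.zp (u : ZMod p) = m
    · rw [if_pos hm]
      exact (PMF.lexp_le_one _ fun c => PMF.coe_le_one _ _).trans le_add_self
    · rw [if_neg hm, add_zero]
      refine PMF.lexp_mono _ fun c => ?_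
      by_cases hA : Accepts S P y v x u c.snd <;> simp [hA, hm]
  · intro a b ha hb
    simpa [Units.ext_iff] using ha.trans hb.symm

open Classical in
/-- The probability that an attempt succeeds. -/
noncomputable def acceptProb (A₁ : Prog) (P : G₁) (y v : G₂) (a : Val p G₁ G₂) : ℝ≥0∞ :=
  (attemptDist S A₁ P y v a.fst a.snd).lexp fun r => if r = .nil then 0 else 1

open Classical in
/-- The probability that an attempt and then one of `N` rewindings succeed. -/
noncomputable def forkProb (N : ℕ) (A₁ : Prog) (P : G₁) (y v : G₂) (a : Val p G₁ G₂) : ℝ≥0∞ :=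
  (attemptDist S A₁ P y v a.fst a.snd).lexp fun r => if r = .nil then 0 else
    (retry (rewindDist S A₁ P y v a.fst a.snd r.fst) N).lexp fun r' => if r' = .nil then 0 else 1

/-- No preimage can be extracted from `r` and `r'` if the private key contains `s`. -/
def Degenerate (r r' : Val p G₁ G₂) (s : ZMod p) : Prop :=
  ∃ m a m' a' : ZMod p, r.fst = .zp m ∧ r.snd.snd = .zp a ∧ r'.fst = .zp m' ∧
    r'.snd.snd = .zp a' ∧ a' + -a + (m + -m') * s = 0

open Classical in
/-- The probability that an attempt and then one of `N` rewindings succeed, such that a preimage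
can be extracted. -/
noncomputable def extractProb (N : ℕ) (A₁ : Prog) (P : G₁) (y v : G₂) (a : Val p G₁ G₂)
    (s : ZMod p) : ℝ≥0∞ :=
  (attemptDist S A₁ P y v a.fst a.snd).lexp fun r => if r = .nil then 0 else
    (retry (rewindDist S A₁ P y v a.fst a.snd r.fst) N).lexp fun r' =>
      if r' = .nil ∨ Degenerate r r' s then 0 else 1

theorem attemptDist_nil_add_acceptProb (A₁ : Prog) (P : G₁) (y v : G₂) (a : Val p G₁ G₂) :
    attemptDist S A₁ P y v a.fst a.snd .nil + acceptProb S A₁ P y v a = 1 := by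
  classical
  rw [acceptProb]
  convert PMF.apply_add_lexp_ne (attemptDist S A₁ P y v a.fst a.snd) .nil

/-- For a fixed state and commitment the rewindings are independent, so the last factor bounds the
probability that all `N` of them fail after an accepted attempt. -/
theorem acceptProb_le_forkProb_add (N : ℕ) (A₁ : Prog) (P : G₁) (y v : G₂) (a : Val p G₁ G₂) :
    acceptProb S A₁ P y v a ≤ forkProb S N A₁ P y v a + acceptProb S A₁ P y v a *
      (attemptDist S A₁ P y v a.fst a.snd .nil + (Fintype.card (ZMod p)ˣ : ℝ≥0∞)⁻¹) ^ N := by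
  classical
  rw [acceptProb, forkProb, ← PMF.lexp_mul_right, ← PMF.lexp_add]
  refine PMF.lexp_mono _ fun r => ?_
  by_cases hr : r = .nil
  · simp [hr]
  · simp only [hr, if_false, one_mul]
    refine (PMF.apply_add_lexp_ne (retry (rewindDist S A₁ P y v a.fst a.snd r.fst) N) .nil).ge.trans
      ?_
    rw [add_comm, retry_apply_nil]
    exact add_le_add_right (pow_le_pow_left' (rewindDist_nil_le ..) N) _

/-- Both transcripts are produced from `v` without `s`, so `s` may be drawn after them. Degeneracy
is then a linear equation in `s` with coefficient `m - m' ≠ 0`, which excludes at most one unit. -/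
theorem forkProb_mul_le (N : ℕ) (A₁ : Prog) (P : G₁) (y v : G₂) (a : Val p G₁ G₂) :
    forkProb S N A₁ P y v a * (1 - (Fintype.card (ZMod p)ˣ : ℝ≥0∞)⁻¹) ≤
      (PMF.uniformOfFintype (ZMod p)ˣ).lexp fun s => extractProb S N A₁ P y v a s := by
  classical
  simp only [extractProb, forkProb]
  rw [← PMF.lexp_mul_right, PMF.lexp_comm]
  refine PMF.lexp_mono _ fun r => ?_
  by_cases hr : r = .nil
  · simp [hr]
  simp only [hr, if_false]
  rw [← PMF.lexp_mul_right, PMF.lexp_comm]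
  refine PMF.lexp_mono_support _ fun r' hs => ?_
  by_cases hr' : r' = .nil
  · simp [hr']
  simp only [hr', if_false, false_or, one_mul, tsub_le_iff_right]
  have hne := (rewindDist_support S (retry_support hs hr') hr').2
  refine le_trans (le_of_eq ?_) (add_le_add_right (PMF.lexp_uniform_subsingleton_le
    (α := (ZMod p)ˣ) (s := fun u => Degenerate r r' u) ?_) _)
  · rw [← PMF.lexp_add, ← PMF.lexp_const (PMF.uniformOfFintype (ZMod p)ˣ) 1]
    congr 1
    funext u
    by_cases h : Degenerate r r' u <;> simp [h]
  · rintro u w ⟨m, b, m', b', h1, h2, h3, h4, h5⟩ ⟨n, d, n', d', g1, g2, g3, g4, g5⟩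
    obtain rfl : m = n := by simpa using h1.symm.trans g1
    obtain rfl : b = d := by simpa using h2.symm.trans g2
    obtain rfl : m' = n' := by simpa using h3.symm.trans g3
    obtain rfl : b' = d' := by simpa using h4.symm.trans g4
    have hm : m + -m' ≠ 0 := by
      rw [← sub_eq_add_neg, sub_ne_zero]
      rintro rfl
      exact hne (h3.trans h1.symm)
    exact Units.ext (mul_left_cancel₀ hm (by linear_combination h5 - g5))

/-- The distribution of the state and the commitment of the cheating prover. -/
noncomputable def contextDist {q : ℕ} (B : CheatingVerifier scheme.rounds q) (A₀ : Prog)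
    (P Q : G₁) (y : G₂) (s : ZMod p) : PMF (Val p G₁ G₂) :=
  (scheme.learn S B (privateKey Q s) (publicKey P y (keyImage p S P Q y s))).bind fun T =>
    A₀.eval S (.pair (.pair (publicKey P y (keyImage p S P Q y s)) T) .nil)

/-- The distribution of the state and the commitment of the cheating prover for a given public
key. -/
noncomputable def viewDist {q : ℕ} (B : CheatingVerifier scheme.rounds q) (A₀ : Prog)
    (P : G₁) (y v : G₂) : PMF (Val p G₁ G₂) :=
  -- Any private key that matches `v` would do; `s = 1` is an arbitrary choice. For `P = 1` the
  -- inverse may be a default value, and `viewExp` omits this case.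
  contextDist S B A₀ P (Function.invFun (fun Q => keyImage p S P Q y 1) v) y 1

theorem keyImage_bijective {S : Setting G₁ G₂} (h₁ : Fintype.card G₁ = p)
    (h₂ : Fintype.card G₂ = p) (he : IsCryptographicPairing S.e) {P : G₁} (hP : P ≠ 1) (y : G₂)
    (s : ZMod p) : Function.Bijective fun Q => keyImage p S P Q y s :=
  (Group.mulRight_bijective (y ^ (-s).val)).comp
    ((Equiv.inv G₂).bijective.comp (he.right_bijective h₁ h₂ hP))

theorem contextDist_eq_viewDist {S : Setting G₁ G₂} (hc : IsCyclic G₁)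
    (h₁ : Fintype.card G₁ = p) (h₂ : Fintype.card G₂ = p) (he : IsCryptographicPairing S.e)
    {q : ℕ} (B : CheatingVerifier scheme.rounds q) (A₀ : Prog)
    {P : G₁} (hP : P ≠ 1) (Q : G₁) (y : G₂) (s : ZMod p) :
    contextDist S B A₀ P Q y s = viewDist S B A₀ P y (keyImage p S P Q y s) := by
  have h : keyImage p S P (Function.invFun (fun Q => keyImage p S P Q y 1)
      (keyImage p S P Q y s)) y 1 = keyImage p S P Q y s :=
    Function.invFun_eq ((keyImage_bijective h₁ h₂ he hP y 1).2 _)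
  rw [viewDist, contextDist, contextDist, learn_eq_of_keyImage_eq hc h₁ h₂ he hP h.symm, h]

end OneWayId

/-! ### Averages over keys: attack, trial and inverter -/

namespace OneWayId

variable {p : ℕ} [Fact p.Prime] {G₁ : Type*} {G₂ : Type*} [CommGroup G₁] [CommGroup G₂]
  [Fintype G₁] [Fintype G₂] (S : Setting G₁ G₂)

theorem verdict_apply_true (A : Machine scheme.rounds) (sA : Val p G₁ G₂) (P : G₁) (y v : G₂) :
    scheme.verdict S A sA (publicKey P y v) true =
      ((A (0 : Fin 2)).eval S (.pair sA .nil)).lexp fun a =>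
        acceptProb S (A (1 : Fin 2)) P y v a := by
  classical
  have h : interact S scheme.rounds A scheme.verifier sA (publicKey P y v) .nil =
      ((A (0 : Fin 2)).eval S (.pair sA .nil)).bind fun a =>
      (challenge.eval S (.pair (publicKey P y v) a.snd)).bind fun b =>
      ((A (1 : Fin 2)).eval S (.pair a.fst b.snd)).bind fun c =>
      (verify.eval S (.pair b.fst c.snd)).bind fun d => PMF.pure (d.fst, d.snd) := rfl
  rw [IdScheme.verdict, PMF.map_apply_eq_lexp, h]
  simp only [acceptProb, attemptDist, PMF.lexp_bind, PMF.lexp_pure, eval_challenge, eval_verify,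
    Val.fst_pair, Val.snd_pair, Val.truth_ofBool, decide_eq_true_eq]
  congr 1
  funext a
  congr 1
  funext m
  congr 1
  funext c
  by_cases h : Accepts S P y v a.snd m c.snd <;> simp [h]

theorem attack_apply_true (α : List Bool) {q : ℕ} (B : CheatingVerifier scheme.rounds q)
    (A : Machine scheme.rounds) :
    scheme.attack p S α B A true =
      (PMF.uniformOfFintype G₁).lexp fun P => (PMF.uniformOfFintype G₂).lexp fun y =>
      (PMF.uniformOfFintype G₁).lexp fun Q => (PMF.uniformOfFintype (ZMod p)ˣ).lexp fun s =>
      (contextDist S B (A (0 : Fin 2)) P Q y (s : ZMod p)).lexp fun a =>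
        acceptProb S (A (1 : Fin 2)) P y (keyImage p S P Q y s) a := by
  have h : ∀ k : Val p G₁ G₂, scheme.gen.eval S k = gen.eval S k := fun _ => rfl
  simp only [IdScheme.attack, h, eval_gen, PMF.bind_bind, PMF.pure_bind, PMF.bind_apply_eq_lexp,
    Val.fst_pair, Val.snd_pair, verdict_apply_true, contextDist, PMF.lexp_bind]
  congr 1
  funext P
  rw [PMF.lexp_comm]

theorem lexp_trial {q : ℕ} (B : CheatingVerifier scheme.rounds q) (A : Machine scheme.rounds)
    (g : G₁) (x : G₂) (φ : Val p G₁ G₂ → ℝ≥0∞) :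
    ((trial B A).eval S (.pair (.g1 g) (.g2 x))).lexp φ =
      (PMF.uniformOfFintype (ZMod p)).lexp fun α => (PMF.uniformOfFintype G₁).lexp fun W =>
      (PMF.uniformOfFintype G₁).lexp fun Q => (PMF.uniformOfFintype (ZMod p)ˣ).lexp fun s =>
      (contextDist S B (A (0 : Fin 2)) (g ^ α.val) Q (x * S.e g W) (s : ZMod p)).lexp fun a =>
      (attemptDist S (A (1 : Fin 2)) (g ^ α.val) (x * S.e g W)
        (keyImage p S (g ^ α.val) Q (x * S.e g W) s) a.fst a.snd).lexp fun r =>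
      φ (if r.truth then .pair (.pair (.pair (.pair (.zp α) (.g1 W))
        (.pair (privateKey Q s) (publicKey (g ^ α.val) (x * S.e g W)
          (keyImage p S (g ^ α.val) Q (x * S.e g W) s)))) a) r else .nil) := by
  simp only [eval_trial, PMF.lexp_bind, PMF.lexp_pure, contextDist]

variable {S}

/-- Random self-reduction: `α ↦ g ^ α` and `W ↦ x · e(g, W)` are bijections, so a fixed instance
leads to uniform `P` and `y`. -/
theorem lexp_randomized (h₁ : Fintype.card G₁ = p) (h₂ : Fintype.card G₂ = p)
    (he : IsCryptographicPairing S.e) {g : G₁} (hg : g ≠ 1) (x : G₂) (ψ : G₁ → G₂ → ℝ≥0∞) :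
    ((PMF.uniformOfFintype (ZMod p)).lexp fun α => (PMF.uniformOfFintype G₁).lexp fun W =>
      ψ (g ^ α.val) (x * S.e g W)) =
    (PMF.uniformOfFintype G₁).lexp fun P => (PMF.uniformOfFintype G₂).lexp fun y => ψ P y := by
  rw [← PMF.lexp_uniform_bijective (pow_val_bijective h₁ hg)]
  congr 1
  funext α
  exact PMF.lexp_uniform_bijective
    ((Group.mulLeft_bijective x).comp (he.right_bijective h₁ h₂ hg)) (ψ (g ^ α.val))

/-- A trial succeeds with the same probability as the attack. -/
theorem trial_nil_add_attack (h₁ : Fintype.card G₁ = p) (h₂ : Fintype.card G₂ = p)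
    (he : IsCryptographicPairing S.e) {g : G₁} (hg : g ≠ 1) (x : G₂) (α : List Bool) {q : ℕ}
    (B : CheatingVerifier scheme.rounds q) (A : Machine scheme.rounds) :
    (trial B A).eval S (.pair (.g1 g) (.g2 x) : Val p G₁ G₂) .nil + scheme.attack p S α B A true =
      1 := by
  classical
  rw [← PMF.apply_add_lexp_ne ((trial B A).eval S (.pair (.g1 g) (.g2 x) : Val p G₁ G₂)) .nil,
    attack_apply_true, lexp_trial, ← lexp_randomized h₁ h₂ he hg x]
  congr! 13 with α W Q s a
  rw [acceptProb]
  congr 1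
  funext r
  by_cases hr : r = .nil
  · simp [hr]
  · simp [hr, (Val.truth_eq_true_iff r).2 hr]

open Classical in
/-- The average of a function of the public key and the commitment of the cheating prover, over the
public keys with `P ≠ 1`. -/
noncomputable def viewExp (p : ℕ) [Fact p.Prime] {G₁ : Type*} {G₂ : Type*} [CommGroup G₁]
    [CommGroup G₂] [Fintype G₁] [Fintype G₂] (S : Setting G₁ G₂) {q : ℕ}
    (B : CheatingVerifier scheme.rounds q) (A₀ : Prog)
    (θ : G₁ → G₂ → G₂ → Val p G₁ G₂ → ℝ≥0∞) : ℝ≥0∞ :=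
  (PMF.uniformOfFintype G₁).lexp fun P => if P = 1 then 0 else
    (PMF.uniformOfFintype G₂).lexp fun y => (PMF.uniformOfFintype G₂).lexp fun v =>
      (viewDist S B A₀ P y v).lexp (θ P y v)

/-- For each `s` the map `Q ↦ v` is bijective, so `v` is uniform and independent of `s`. The context
depends on the key pair only through the public key, hence `s` can be drawn last. -/
theorem lexp_key_eq (hc : IsCyclic G₁) (h₁ : Fintype.card G₁ = p) (h₂ : Fintype.card G₂ = p)
    (he : IsCryptographicPairing S.e) {q : ℕ} (B : CheatingVerifier scheme.rounds q) (A₀ : Prog)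
    {P : G₁} (hP : P ≠ 1) (y : G₂) (θ : G₂ → ZMod p → Val p G₁ G₂ → ℝ≥0∞) :
    ((PMF.uniformOfFintype G₁).lexp fun Q => (PMF.uniformOfFintype (ZMod p)ˣ).lexp fun s =>
      (contextDist S B A₀ P Q y (s : ZMod p)).lexp fun a => θ (keyImage p S P Q y s) s a) =
    (PMF.uniformOfFintype G₂).lexp fun v => (viewDist S B A₀ P y v).lexp fun a =>
      (PMF.uniformOfFintype (ZMod p)ˣ).lexp fun s => θ v s a := by
  simp only [contextDist_eq_viewDist hc h₁ h₂ he B A₀ hP]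
  rw [PMF.lexp_comm]
  calc _ = (PMF.uniformOfFintype (ZMod p)ˣ).lexp fun s => (PMF.uniformOfFintype G₂).lexp fun v =>
        (viewDist S B A₀ P y v).lexp (θ v s) := by
        congr 1
        funext s
        exact PMF.lexp_uniform_bijective (keyImage_bijective h₁ h₂ he hP y s) fun v =>
          (viewDist S B A₀ P y v).lexp (θ v s)
    _ = _ := by
        rw [PMF.lexp_comm]
        congr 1
        funext v
        rw [PMF.lexp_comm]

/-- The term `1/p` pays for `P = 1`, where `e P` is not injective and witness indistinguishability
is not available. -/
theorem attack_le (hc : IsCyclic G₁) (h₁ : Fintype.card G₁ = p) (h₂ : Fintype.card G₂ = p)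
    (he : IsCryptographicPairing S.e) (α : List Bool) {q : ℕ}
    (B : CheatingVerifier scheme.rounds q) (A : Machine scheme.rounds) :
    scheme.attack p S α B A true ≤
      viewExp p S B (A (0 : Fin 2)) (acceptProb S (A (1 : Fin 2))) + (p : ℝ≥0∞)⁻¹ := by
  classical
  have h := PMF.lexp_uniform_subsingleton_le (α := G₁) (s := fun P => P = 1) fun _ _ ha hb =>
    ha.trans hb.symm
  rw [h₁] at h
  refine le_trans ?_ (add_le_add_right h _)
  rw [attack_apply_true, viewExp, ← PMF.lexp_add]
  refine PMF.lexp_mono _ fun P => ?_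
  by_cases hP : P = 1
  · simp only [hP, if_true, zero_add]
    refine PMF.lexp_le_one _ fun y => PMF.lexp_le_one _ fun Q => PMF.lexp_le_one _ fun s =>
      PMF.lexp_le_one _ fun a => ?_
    exact PMF.lexp_le_one _ fun r => by split_ifs <;> simp
  · simp only [hP, if_false, add_zero]
    refine PMF.lexp_mono _ fun y => ?_
    rw [lexp_key_eq hc h₁ h₂ he B _ hP y fun v _ a => acceptProb S (A (1 : Fin 2)) P y v a]
    simp

theorem viewExp_mono {q : ℕ} (B : CheatingVerifier scheme.rounds q) (A₀ : Prog)
    {θ θ' : G₁ → G₂ → G₂ → Val p G₁ G₂ → ℝ≥0∞} (h : ∀ P y v a, θ P y v a ≤ θ' P y v a) :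
    viewExp p S B A₀ θ ≤ viewExp p S B A₀ θ' := by
  classical
  refine PMF.lexp_mono _ fun P => ?_
  split_ifs
  · exact le_rfl
  · exact PMF.lexp_mono _ fun y => PMF.lexp_mono _ fun v => PMF.lexp_mono _ fun a => h ..

theorem viewExp_add_const_le {q : ℕ} (B : CheatingVerifier scheme.rounds q) (A₀ : Prog)
    (θ : G₁ → G₂ → G₂ → Val p G₁ G₂ → ℝ≥0∞) (b : ℝ≥0∞) :
    viewExp p S B A₀ (fun P y v a => θ P y v a + b) ≤ viewExp p S B A₀ θ + b := by
  classical
  rw [viewExp, viewExp, ← PMF.lexp_const (PMF.uniformOfFintype G₁) b, ← PMF.lexp_add]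
  refine PMF.lexp_mono _ fun P => ?_
  split_ifs
  · simp
  · simp [PMF.lexp_add]

/-- The success probability of the inverter on `(g, x)`. -/
theorem le_inverter_success (hc : IsCyclic G₁) (h₁ : Fintype.card G₁ = p)
    (h₂ : Fintype.card G₂ = p) (he : IsCryptographicPairing S.e) {g : G₁} (hg : g ≠ 1) (x : G₂)
    (N : ℕ) {q : ℕ} (B : CheatingVerifier scheme.rounds q) (A : Machine scheme.rounds)
    (good : Val p G₁ G₂ → ℝ≥0∞) (hgood : ∀ h : G₁, S.e g h = x → good (.g1 h) = 1) :
    (∑ i ∈ Finset.range N, (trial B A).eval S (.pair (.g1 g) (.g2 x) : Val p G₁ G₂) .nil ^ i) *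
        (viewExp p S B (A (0 : Fin 2)) (forkProb S N (A (1 : Fin 2))) *
          (1 - (Fintype.card (ZMod p)ˣ : ℝ≥0∞)⁻¹)) ≤
      ((inverter N B A).eval S (.pair (.g1 g) (.g2 x) : Val p G₁ G₂)).lexp good := by
  classical
  -- The value of the second half of the inverter on the data `z` of a trial, set to `0` at `nil` as
  -- `lexp_retry` requires.
  let φ : Val p G₁ G₂ → ℝ≥0∞ := fun z => if z = .nil then 0 else
    (retry ((rewind (A (1 : Fin 2))).eval S z) N).lexp fun r =>
      (extract.eval S (.pair z r)).lexp good
  calc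
    _ ≤ (∑ i ∈ Finset.range N, (trial B A).eval S (.pair (.g1 g) (.g2 x) : Val p G₁ G₂) .nil ^ i) *
          ((trial B A).eval S (.pair (.g1 g) (.g2 x))).lexp φ := by
        gcongr
        calc
          _ ≤ (PMF.uniformOfFintype G₁).lexp fun P => (PMF.uniformOfFintype G₂).lexp fun y =>
              (PMF.uniformOfFintype G₁).lexp fun Q =>
              (PMF.uniformOfFintype (ZMod p)ˣ).lexp fun s =>
              (contextDist S B (A (0 : Fin 2)) P Q y (s : ZMod p)).lexp fun a =>
                extractProb S N (A (1 : Fin 2)) P y (keyImage p S P Q y s) a (s : ZMod p) := by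
            rw [viewExp, ← PMF.lexp_mul_right]
            refine PMF.lexp_mono _ fun P => ?_
            by_cases hP : P = 1
            · simp [hP]
            rw [if_neg hP, ← PMF.lexp_mul_right]
            refine PMF.lexp_mono _ fun y => ?_
            rw [lexp_key_eq hc h₁ h₂ he B _ hP y fun v s a =>
              extractProb S N (A (1 : Fin 2)) P y v a s, ← PMF.lexp_mul_right]
            refine PMF.lexp_mono _ fun v => ?_
            rw [← PMF.lexp_mul_right]
            exact PMF.lexp_mono _ fun a => forkProb_mul_le ..
          _ ≤ _ := by
            -- Both sides now average over the same random choices and are compared pointwise: a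
            -- nondegenerate pair of transcripts gives a preimage.
            rw [← lexp_randomized h₁ h₂ he hg x, lexp_trial]
            refine PMF.lexp_mono _ fun α => PMF.lexp_mono _ fun W => PMF.lexp_mono _ fun Q =>
              PMF.lexp_mono _ fun s => PMF.lexp_mono _ fun a => ?_
            refine PMF.lexp_mono_support _ fun r hr => ?_
            by_cases hn : r = .nil
            · simp [hn]
            obtain ⟨m, c, rfl, T, b, hT, hb, hx⟩ := attemptDist_support S hr hn
            simp only [hn, if_false, Val.truth_pair, if_true, φ, reduceCtorEq]
            rw [eval_rewind S (m := m) _ _ _ _ _ _ _ _ rfl]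
            refine PMF.lexp_mono_support _ fun r' hr' => ?_
            by_cases hn' : r' = .nil
            · simp [hn']
            obtain ⟨m', c', rfl, T', b', hT', hb', hx'⟩ := attemptDist_support S
              (rewindDist_support S (retry_support hr' hn') hn').1 hn'
            by_cases hd : Degenerate (.pair (.zp m) c) (.pair (.zp m') c') (s : ZMod p)
            · exact (if_pos (Or.inr hd)).le.trans zero_le
            · rw [eval_extract S α s m m' b b' W Q T T' _ _ _ _ hT hb hT' hb', PMF.lexp_pure,
                hgood]
              · exact (if_neg (by simpa using hd)).le
              refine pairing_extracted hc h₂ he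
                (fun h0 => hd ⟨m, b, m', b', rfl, hb, rfl, hb', h0⟩) ?_
              simpa using hx.symm.trans hx'
    _ = (retry ((trial B A).eval S (.pair (.g1 g) (.g2 x))) N).lexp φ := by
        rw [lexp_retry _ _ (by simp [φ])]
    _ ≤ _ := by
        simp only [inverter, Prog.eval_seq, Prog.eval_fork, Prog.eval_id, Prog.eval_retry,
          PMF.lexp_bind, PMF.lexp_pure]
        refine PMF.lexp_mono _ fun z => ?_
        simp only [φ]
        -- If all trials fail, the program still runs on; whatever it gains then is discarded.
        split_ifs
        · exact zero_le
        · exact le_rfl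

end OneWayId

/-! ### Elementary estimates -/

section RealInequalities

/-- The left side is maximal at `t = 1`; passing from `n` to `n + 1` decreases it by exactly `(n +
1) * t ^ n * (1 - t) ^ 2`. -/
theorem pow_mul_succ_sub_le_one {t : ℝ} (ht : 0 ≤ t) (n : ℕ) :
    t ^ n * ((n + 1) - n * t) ≤ 1 := by
  induction n with
  | zero => simp
  | succ n ih =>
    have h : 0 ≤ (n + 1) * t ^ n * (1 - t) ^ 2 := by positivity
    push_cast
    linear_combination ih + h

theorem div_succ_pow_le_half {n : ℕ} (hn : 1 ≤ n) : ((n : ℝ) / (n + 1)) ^ n ≤ 1 / 2 := by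
  have hn' : (0 : ℝ) < n := by exact_mod_cast hn
  have h : (2 : ℝ) ≤ (1 + 1 / n) ^ n := by
    have h := one_add_mul_le_pow (a := 1 / (n : ℝ)) (by
      have : 0 ≤ 1 / (n : ℝ) := by positivity
      linarith) n
    rw [mul_one_div_cancel hn'.ne'] at h
    linarith
  have he : (n : ℝ) / (n + 1) = (1 + 1 / (n : ℝ))⁻¹ := by
    field_simp
  rw [he, inv_pow, one_div (2 : ℝ)]
  exact inv_anti₀ (by norm_num) h

/-- The maximum is at `f = (1 + η) / (n + 1)`, and there `(n / (n + 1)) ^ n ≤ 1/2` supplies the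
factor `2` in the denominator. -/
theorem mul_one_sub_add_pow_le {f η : ℝ} (hf1 : f ≤ 1) (hη : 0 ≤ η) {n : ℕ}
    (hn : 1 ≤ n) :
    f * (1 - f + η) ^ n ≤ (1 + η) ^ (n + 1) / (2 * (n + 1)) := by
  have hn' : (0 : ℝ) < n := by exact_mod_cast hn
  have hη' : 0 < 1 + η := by linarith
  -- The value of `1 - f + η` at the maximum, so that `t = 1` is the extremal case.
  set c : ℝ := n / (n + 1) * (1 + η) with hc
  have hc0 : 0 < c := by positivity
  set t := (1 - f + η) / c with ht
  have ht0 : 0 ≤ t := div_nonneg (by linarith) hc0.le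
  have hu : 1 - f + η = c * t := by
    rw [ht]
    field_simp
  have hf : f = (1 + η) / (n + 1) * ((n + 1) - n * t) := by
    have : f = 1 + η - c * t := by linarith
    rw [this, hc]
    field_simp
  calc f * (1 - f + η) ^ n = (1 + η) / (n + 1) * c ^ n * (t ^ n * ((n + 1) - n * t)) := by
        rw [hu, mul_pow]
        nth_rw 1 [hf]
        ring
    _ ≤ (1 + η) / (n + 1) * c ^ n * 1 := by
        gcongr
        exact pow_mul_succ_sub_le_one ht0 n
    _ = (1 + η) ^ (n + 1) / (n + 1) * ((n : ℝ) / (n + 1)) ^ n := by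
        rw [hc, mul_pow]
        ring
    _ ≤ (1 + η) ^ (n + 1) / (n + 1) * (1 / 2) := by
        gcongr
        exact div_succ_pow_le_half hn
    _ = _ := by
        field_simp

/-- The lower bound for the success probability of the inverter. -/
theorem inverter_success_bound {p ε a V : ℝ} {N : ℕ} (hε : 0 < ε) (hp : 100 / p < ε) (hp0 : 0 < p)
    (ha : ε ≤ a) (ha1 : a ≤ 1) (hN : N ≤ 1 / ε) (hN' : 1 / ε < N + 1) (hN1 : 1 ≤ N)
    (hV : a ≤ V + (1 + 1 / (p - 1)) ^ (N + 1) / (2 * (N + 1)) + 1 / p) :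
    3 / 16 ≤ (∑ i ∈ Finset.range N, (1 - a) ^ i) * (V * (1 - 1 / (p - 1))) * (1 - 1 / p) := by
  have hε1 : ε ≤ 1 := ha.trans ha1
  have ha0 : 0 < a := hε.trans_le ha
  have hpε : 100 < p * ε := by
    rw [div_lt_iff₀ hp0] at hp
    linarith
  have hp100 : 100 < p := by nlinarith
  have hN0 : (0 : ℝ) < N + 1 := by positivity
  have hNε : 1 < ε * (N + 1) := by
    rw [div_lt_iff₀ hε] at hN'
    linarith
  have hNε' : ε * N ≤ 1 := by
    rw [le_div_iff₀ hε] at hN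
    linarith
  have hη0 : 0 < p - 1 := by linarith
  have hη : 1 / (p - 1) ≤ 1 / 99 := one_div_le_one_div_of_le (by norm_num) (by linarith)
  -- Indeed `N + 1 ≤ 2 / ε < p / 50`.
  have hη' : 1 / (p - 1) * (N + 1) ≤ 1 / 25 := by
    rw [one_div_mul_eq_div, div_le_iff₀ hη0]
    nlinarith
  have hpow : (1 + 1 / (p - 1)) ^ (N + 1) ≤ 25 / 24 := by
    calc (1 + 1 / (p - 1)) ^ (N + 1) ≤ Real.exp (1 / (p - 1)) ^ (N + 1) := by
          gcongr
          rw [add_comm]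
          exact Real.add_one_le_exp _
      _ = Real.exp (1 / (p - 1) * (N + 1)) := by
          rw [← Real.exp_nat_mul]
          push_cast
          ring_nf
      _ ≤ Real.exp (1 / 25) := Real.exp_le_exp.2 hη'
      _ ≤ 1 / (1 - 1 / 25) := Real.exp_bound_div_one_sub_of_interval (by norm_num) (by norm_num)
      _ = 25 / 24 := by norm_num
  have hB : (1 + 1 / (p - 1)) ^ (N + 1) / (2 * (N + 1)) ≤ 25 / 48 * ε := by
    rw [div_le_iff₀ (by positivity)]
    nlinarith
  have hp' : 1 / p ≤ ε / 100 := by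
    rw [div_le_iff₀ hp0]
    linarith
  -- The losses are `25/48 * ε` and `ε / 100`, with `ε ≤ a`, and `1 - 25/48 - 1/100 > 46/100`.
  have hVa : 46 / 100 * a ≤ V := by linarith
  -- The sum is `(1 - (1 - a) ^ N) / a`, and `a ≥ ε > 1 / (N + 1)` bounds the power by `(N / (N +
  -- 1)) ^ N`.
  have hgeom : 1 / (2 * a) ≤ ∑ i ∈ Finset.range N, (1 - a) ^ i := by
    have h := geom_sum_mul_neg (1 - a) N
    have h2 : (1 - a) ^ N ≤ 1 / 2 := by
      refine le_trans ?_ (div_succ_pow_le_half hN1)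
      refine pow_le_pow_left₀ (by linarith) ?_ _
      rw [le_div_iff₀ hN0]
      nlinarith
    rw [sub_sub_cancel] at h
    rw [div_le_iff₀ (by positivity)]
    linarith
  have hV0 : 0 ≤ V := le_trans (by positivity) hVa
  have hs : 0 ≤ ∑ i ∈ Finset.range N, (1 - a) ^ i := le_trans (by positivity) hgeom
  have hp100' : 1 / p ≤ 1 / 100 := one_div_le_one_div_of_le (by norm_num) hp100.le
  calc (3 : ℝ) / 16 ≤ 1 / 2 * (46 / 100 * (98 / 99)) * (99 / 100) := by norm_num
    _ = 1 / (2 * a) * (46 / 100 * a * (98 / 99)) * (99 / 100) := by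
        field_simp
    _ ≤ _ := by
        exact mul_le_mul (mul_le_mul hgeom (mul_le_mul hVa (by linarith) (by norm_num) hV0)
          (by positivity) hs) (by linarith) (by norm_num)
          (mul_nonneg hs (mul_nonneg hV0 (by linarith)))

end RealInequalities

/-! ### Success probability of the inverter -/

namespace OneWayId

variable {p : ℕ} [Fact p.Prime] {G₁ : Type*} {G₂ : Type*} [CommGroup G₁] [CommGroup G₂]
  [Fintype G₁] [Fintype G₂] {S : Setting G₁ G₂}

theorem inv_card_units (p : ℕ) [Fact p.Prime] :
    (Fintype.card (ZMod p)ˣ : ℝ≥0∞)⁻¹ = ENNReal.ofReal (1 / (p - 1)) := by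
  have h := (Fact.out : p.Prime).two_le
  have h' : (2 : ℝ) ≤ p := by exact_mod_cast h
  rw [ZMod.card_units, one_div, ENNReal.ofReal_inv_of_pos (by linarith),
    ← ENNReal.ofReal_natCast, Nat.cast_sub (by omega), Nat.cast_one]

/-- The loss does not depend on the state and commitment, so it survives averaging over them and no
convexity argument is needed. -/
theorem acceptProb_le (N : ℕ) (hN : 1 ≤ N) (A₁ : Prog) (P : G₁) (y v : G₂) (a : Val p G₁ G₂) :
    acceptProb S A₁ P y v a ≤ forkProb S N A₁ P y v a +
      ENNReal.ofReal ((1 + 1 / (p - 1)) ^ (N + 1) / (2 * (N + 1))) := by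
  refine (acceptProb_le_forkProb_add S N A₁ P y v a).trans (add_le_add_right ?_ _)
  have h := attemptDist_nil_add_acceptProb S A₁ P y v a
  have h' : (2 : ℝ) ≤ p := by exact_mod_cast (Fact.out : p.Prime).two_le
  have hη : (0 : ℝ) ≤ 1 / (p - 1) := one_div_nonneg.2 (by linarith)
  have hf1 : acceptProb S A₁ P y v a ≤ 1 := h ▸ le_add_self
  have hft : acceptProb S A₁ P y v a ≠ ⊤ := ne_top_of_le_ne_top ENNReal.one_ne_top hf1
  have hn : attemptDist S A₁ P y v a.fst a.snd .nil = 1 - acceptProb S A₁ P y v a :=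
    ENNReal.eq_sub_of_add_eq hft h
  lift acceptProb S A₁ P y v a to NNReal using hft with f
  have hf1' : (f : ℝ) ≤ 1 := by exact_mod_cast hf1
  have he : (f : ℝ≥0∞) = ENNReal.ofReal f := by simp
  rw [hn, inv_card_units, he, ← ENNReal.ofReal_one, ← ENNReal.ofReal_sub _ f.coe_nonneg,
    ← ENNReal.ofReal_add (by linarith) hη, ← ENNReal.ofReal_pow (by linarith),
    ← ENNReal.ofReal_mul f.coe_nonneg]
  exact ENNReal.ofReal_le_ofReal (mul_one_sub_add_pow_le hf1' hη hN)

open Classical in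
theorem inversionRun_apply_true (C : Prog) :
    inversionRun p S C true =
      (PMF.uniformOfFintype G₁).lexp fun g => (PMF.uniformOfFintype G₂).lexp fun x =>
        (C.eval S (.pair (.g1 g) (.g2 x) : Val p G₁ G₂)).lexp fun v =>
          if ∃ h : G₁, v = .g1 h ∧ S.e g h = x then 1 else 0 := by
  simp only [inversionRun, PMF.bind_apply_eq_lexp, PMF.map_apply_eq_lexp, decide_eq_true_eq]

open Classical in
theorem le_inversionRun (h₁ : Fintype.card G₁ = p) (C : Prog) (c : ℝ≥0∞)
    (hC : ∀ g : G₁, g ≠ 1 → ∀ x : G₂,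
      c ≤ (C.eval S (.pair (.g1 g) (.g2 x) : Val p G₁ G₂)).lexp fun v =>
          if ∃ h : G₁, v = .g1 h ∧ S.e g h = x then 1 else 0) :
    c * (1 - (p : ℝ≥0∞)⁻¹) ≤ inversionRun p S C true := by
  -- Distributing `c` over the truncated subtraction needs `c` finite; an infinite `c` cannot bound
  -- a probability from below.
  by_cases hc : c = ⊤
  · obtain ⟨g, hg⟩ : ∃ g : G₁, g ≠ 1 := by
      have : Nontrivial G₁ := Fintype.one_lt_card_iff_nontrivial.1
        (h₁ ▸ (Fact.out : p.Prime).one_lt)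
      exact exists_ne 1
    have h := (hC g hg 1).trans (PMF.lexp_le_one _ fun v => by split_ifs <;> simp)
    simp [hc] at h
  have h := PMF.lexp_uniform_subsingleton_le (α := G₁) (s := fun g => g = 1) fun _ _ ha hb =>
    ha.trans hb.symm
  rw [h₁] at h
  rw [ENNReal.mul_sub fun _ _ => hc, mul_one, tsub_le_iff_right, inversionRun_apply_true]
  refine le_trans ?_ (add_le_add_right (mul_le_mul_right h c) _)
  rw [← PMF.lexp_mul_left, ← PMF.lexp_add]
  refine (PMF.lexp_const (PMF.uniformOfFintype G₁) c).ge.trans (PMF.lexp_mono _ fun g => ?_)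
  by_cases hg : g = 1
  · simp [hg]
  · simp only [hg, if_false, mul_zero, add_zero]
    exact (PMF.lexp_const (PMF.uniformOfFintype G₂) c).ge.trans (PMF.lexp_mono _ fun x => hC g hg x)

theorem inverter_success (hc : IsCyclic G₁) (h₁ : Fintype.card G₁ = p)
    (h₂ : Fintype.card G₂ = p) (he : IsCryptographicPairing S.e) {ε : ℝ} (hε : 0 < ε)
    (hp : 100 / p < ε) {N : ℕ} (hN : N ≤ 1 / ε) (hN' : 1 / ε < N + 1) (hN1 : 1 ≤ N)
    (α : List Bool) {q : ℕ} (B : CheatingVerifier scheme.rounds q) (A : Machine scheme.rounds)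
    (ha : ε ≤ (scheme.attack p S α B A true).toReal) :
    3 / 16 ≤ (inversionRun p S (inverter N B A) true).toReal := by
  classical
  have hp2 : (2 : ℝ) ≤ p := by exact_mod_cast (Fact.out : p.Prime).two_le
  have hfin : ∀ d : PMF Bool, d true ≠ ⊤ := fun d => d.apply_ne_top true
  set a := (scheme.attack p S α B A true).toReal with ha'
  have ha1 : a ≤ 1 := ENNReal.toReal_le_of_le_ofReal zero_le_one (by
    simpa using PMF.coe_le_one _ _)
  have hatt : scheme.attack p S α B A true = ENNReal.ofReal a :=
    (ENNReal.ofReal_toReal (hfin _)).symm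
  have ha0 : 0 ≤ a := ENNReal.toReal_nonneg
  set V := viewExp p S B (A (0 : Fin 2)) (forkProb S N (A (1 : Fin 2))) with hV
  have hVtop : V ≠ ⊤ := by
    refine ne_top_of_le_ne_top ENNReal.one_ne_top (PMF.lexp_le_one _ fun P => ?_)
    split_ifs
    · exact zero_le
    refine PMF.lexp_le_one _ fun y => PMF.lexp_le_one _ fun v => PMF.lexp_le_one _ fun b =>
      PMF.lexp_le_one _ fun r => ?_
    split_ifs
    · exact zero_le
    · exact PMF.lexp_le_one _ fun r' => by split_ifs <;> simp
  have hpinv : (p : ℝ≥0∞)⁻¹ = ENNReal.ofReal (1 / p) := by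
    rw [one_div, ENNReal.ofReal_inv_of_pos (by linarith), ENNReal.ofReal_natCast]
  have hη : (0 : ℝ) ≤ 1 / (p - 1) := one_div_nonneg.2 (by linarith)
  have hB : (0 : ℝ) ≤ (1 + 1 / (p - 1)) ^ (N + 1) / (2 * (N + 1)) := by positivity
  have hbound : a ≤ V.toReal + (1 + 1 / (p - 1)) ^ (N + 1) / (2 * (N + 1)) + 1 / p := by
    have h := (attack_le hc h₁ h₂ he α B A).trans (add_le_add_left ((viewExp_mono B _
      (acceptProb_le N hN1 (A (1 : Fin 2)))).trans (viewExp_add_const_le B _ _ _)) _)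
    rw [hatt, hpinv, ← hV, ← ENNReal.ofReal_toReal hVtop, ← ENNReal.ofReal_add
      ENNReal.toReal_nonneg hB, ← ENNReal.ofReal_add (by positivity) (by positivity)] at h
    exact (ENNReal.ofReal_le_ofReal_iff (by positivity)).1 h
  have hmain := inverter_success_bound hε hp (by linarith) ha ha1 hN hN' hN1 hbound
  have hη1 : 1 / ((p : ℝ) - 1) ≤ 1 := by
    rw [div_le_one (by linarith)]
    linarith
  have hsum : 0 ≤ ∑ i ∈ Finset.range N, (1 - a) ^ i :=
    Finset.sum_nonneg fun i _ => pow_nonneg (by linarith) _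
  refine hmain.trans ?_
  rw [← ENNReal.ofReal_le_iff_le_toReal (hfin _)]
  refine le_trans (le_of_eq ?_) (le_inversionRun h₁ (inverter N B A) (ENNReal.ofReal
    ((∑ i ∈ Finset.range N, (1 - a) ^ i) * (V.toReal * (1 - 1 / (p - 1))))) fun g hg x => ?_)
  · rw [hpinv, ← ENNReal.ofReal_one, ← ENNReal.ofReal_sub _ (by positivity),
      ← ENNReal.ofReal_mul (mul_nonneg hsum (mul_nonneg ENNReal.toReal_nonneg (by linarith)))]
  · refine le_trans (le_of_eq ?_) (le_inverter_success hc h₁ h₂ he hg x N B A _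
      fun h hh => if_pos ⟨h, rfl, hh⟩)
    have hnil := ENNReal.eq_sub_of_add_eq (hfin _) (trial_nil_add_attack h₁ h₂ he hg x α B A)
    rw [hnil, hatt, ← hV, inv_card_units, ← ENNReal.ofReal_one, ← ENNReal.ofReal_sub _ ha0,
      ← ENNReal.ofReal_sub _ hη, ← ENNReal.ofReal_toReal hVtop,
      ← ENNReal.ofReal_mul ENNReal.toReal_nonneg, ENNReal.ofReal_mul hsum,
      ENNReal.ofReal_sum_of_nonneg fun i _ => pow_nonneg (by linarith) _,
      ENNReal.toReal_ofReal ENNReal.toReal_nonneg]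
    simp only [ENNReal.ofReal_pow (sub_nonneg.2 ha1)]

end OneWayId

/-! ### Guessing a preimage -/

namespace OneWayId

/-- On `(g, x)`, guess a preimage; the result is `nil` if the guess is wrong. -/
def guess : Prog :=
  .seq (.fork .id (.prim .rand1))
    (.cond (bin .eq (bin .pairing (.seq .fst .fst) .snd) (.seq .fst .snd)) .snd .nil)

section Guess

variable {p : ℕ} [Fact p.Prime] {G₁ : Type*} {G₂ : Type*} [CommGroup G₁] [CommGroup G₂]
  [Fintype G₁] [Fintype G₂] {S : Setting G₁ G₂}

open Classical in
theorem eval_guess (g : G₁) (x : G₂) :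
    guess.eval S (.pair (.g1 g) (.g2 x) : Val p G₁ G₂) = (PMF.uniformOfFintype G₁).bind fun h =>
      PMF.pure (if S.e g h = x then .g1 h else .nil) := by
  simp only [guess, bin, Prog.eval, Op.eval, PMF.bind_bind, PMF.pure_bind, PMF.bind_map,
    Function.comp_def, Val.fst_pair, Val.snd_pair, Val.truth_ofBool, decide_eq_true_eq]
  congr 1
  funext h
  by_cases hx : S.e g h = x
  · rw [if_pos hx, if_pos hx]
  · rw [if_neg hx, if_neg hx]

theorem guess_apply_nil (h₁ : Fintype.card G₁ = p) (h₂ : Fintype.card G₂ = p)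
    (he : IsCryptographicPairing S.e) {g : G₁} (hg : g ≠ 1) (x : G₂) :
    guess.eval S (.pair (.g1 g) (.g2 x) : Val p G₁ G₂) .nil = 1 - (p : ℝ≥0∞)⁻¹ := by
  classical
  have h := PMF.apply_add_lexp_ne (guess.eval S (.pair (.g1 g) (.g2 x) : Val p G₁ G₂)) .nil
  have h' : ((guess.eval S (.pair (.g1 g) (.g2 x) : Val p G₁ G₂)).lexp fun b =>
      if b = .nil then 0 else 1) = (p : ℝ≥0∞)⁻¹ := by
    rw [eval_guess]
    simp only [PMF.lexp_bind, PMF.lexp_pure]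
    calc _ = (PMF.uniformOfFintype G₁).lexp fun b => if S.e g b = x then 1 else 0 := by
          congr 1
          funext b
          by_cases hb : S.e g b = x <;> simp [hb]
      _ = (PMF.uniformOfFintype G₂).lexp fun z => if z = x then 1 else 0 :=
          PMF.lexp_uniform_bijective (he.right_bijective h₁ h₂ hg) fun z => if z = x then 1 else 0
      _ = _ := by simp [PMF.lexp_uniform, h₂]
  rw [h'] at h
  exact ENNReal.eq_sub_of_add_eq
    (ENNReal.inv_ne_top.2 (Nat.cast_ne_zero.2 (Fact.out : p.Prime).ne_zero)) h

/-- Each guess is right with probability `1/p`, so `p` guesses all fail with probability at most `(1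
- 1/p) ^ (p - 1) ≤ 1/2`. Excluding `g = 1` costs a factor of at least `16/17`. -/
theorem bruteForce_success (h₁ : Fintype.card G₁ = p) (h₂ : Fintype.card G₂ = p)
    (he : IsCryptographicPairing S.e) (hp : 17 ≤ p) :
    3 / 16 ≤ (inversionRun p S (.retry p guess) true).toReal := by
  classical
  have hp' : (17 : ℝ) ≤ p := by exact_mod_cast hp
  have hinv : 1 / (p : ℝ) ≤ 1 / 17 := one_div_le_one_div_of_le (by norm_num) hp'
  have hinv0 : 0 ≤ 1 / (p : ℝ) := by positivity
  have hpinv : (p : ℝ≥0∞)⁻¹ = ENNReal.ofReal (1 / p) := by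
    rw [one_div, ENNReal.ofReal_inv_of_pos (by linarith), ENNReal.ofReal_natCast]
  have hhalf : (1 - 1 / (p : ℝ)) ^ p ≤ 1 / 2 := by
    obtain ⟨n, hn⟩ : ∃ n, p = n + 1 := ⟨p - 1, by omega⟩
    have hnp : 1 - 1 / (p : ℝ) = n / (n + 1) := by
      rw [hn]
      push_cast
      field_simp
      ring
    calc (1 - 1 / (p : ℝ)) ^ p ≤ (1 - 1 / (p : ℝ)) ^ n :=
          pow_le_pow_of_le_one (by linarith) (by linarith) (by omega)
      _ ≤ 1 / 2 := hnp ▸ div_succ_pow_le_half (by omega)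
  have h := le_inversionRun (S := S) h₁ (.retry p guess) (ENNReal.ofReal (1 / 2))
    fun g hg x => ?_
  · rw [hpinv, ← ENNReal.ofReal_one, ← ENNReal.ofReal_sub _ hinv0, ← ENNReal.ofReal_mul
      (by norm_num), ENNReal.ofReal_le_iff_le_toReal (PMF.apply_ne_top _ _)] at h
    linarith
  · rw [Prog.eval_retry]
    calc ENNReal.ofReal (1 / 2)
        ≤ 1 - retry (guess.eval S (.pair (.g1 g) (.g2 x) : Val p G₁ G₂)) p .nil := by
          rw [retry_apply_nil, guess_apply_nil h₁ h₂ he hg, hpinv, ← ENNReal.ofReal_one,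
            ← ENNReal.ofReal_sub _ hinv0, ← ENNReal.ofReal_pow (by linarith),
            ← ENNReal.ofReal_sub _ (pow_nonneg (by linarith) _)]
          exact ENNReal.ofReal_le_ofReal (by linarith)
      _ = (retry (guess.eval S (.pair (.g1 g) (.g2 x) : Val p G₁ G₂)) p).lexp fun b =>
            if b = .nil then 0 else 1 :=
          ENNReal.sub_eq_of_eq_add_rev (PMF.apply_ne_top _ _) (PMF.apply_add_lexp_ne _ _).symm
      _ ≤ _ := by
          refine PMF.lexp_mono_support _ fun b hb => ?_
          by_cases hn : b = .nil
          · simp [hn]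
          have hs := retry_support hb hn
          rw [eval_guess, ← PMF.mem_support_iff, PMF.mem_support_bind_iff] at hs
          obtain ⟨k, -, hk⟩ := hs
          rw [PMF.mem_support_pure_iff] at hk
          split_ifs at hk with hx
          · rw [if_neg hn, if_pos ⟨k, hk, hx⟩]
          · exact absurd hk hn

end Guess

/-! ### Running times -/

theorem time_bruteForce_le (κ : Op → ℕ) (n : ℕ) :
    (Prog.retry n guess).time κ ≤ (n * (guess.time 0 + 7) + 7) * totalOpCost κ := by
  have h := guess.time_le κ
  have h1 := one_le_totalOpCost κ
  rw [Prog.time_retry]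
  nlinarith [Nat.mul_le_mul_left n h, Nat.mul_le_mul_left n h1]

/-- Putting `.nil` in place of `A₁` isolates the fixed instructions, whose number is an absolute
constant. -/
theorem time_attempt_le (κ : Op → ℕ) (A₁ : Prog) :
    (attempt A₁).time κ ≤ (attempt .nil).time 0 * totalOpCost κ + A₁.time κ := by
  refine le_trans ?_ (add_le_add_left ((attempt .nil).time_le κ) _)
  simp only [attempt, Prog.time]
  omega

theorem time_rewind_le (κ : Op → ℕ) (A₁ : Prog) :
    (rewind A₁).time κ ≤ (rewind .nil).time 0 * totalOpCost κ + A₁.time κ := by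
  refine le_trans ?_ (add_le_add_left ((rewind .nil).time_le κ) _)
  simp only [rewind, attempt, Prog.time]
  omega

theorem time_trial_le (κ : Op → ℕ) {q : ℕ} (B : CheatingVerifier scheme.rounds q)
    (A : Machine scheme.rounds) :
    (trial B A).time κ ≤ (randomizedKeys.time 0 + (attempt .nil).time 0 + 30 +
      q * (commit.time 0 + respond.time 0 + 66)) * totalOpCost κ + B.time κ + A.time κ := by
  have h1 := one_le_totalOpCost κ
  have hk := randomizedKeys.time_le κ
  have ha := time_attempt_le κ (A (1 : Fin 2))
  have hP : scheme.prover.time κ = commit.time κ + respond.time κ := Fin.sum_univ_two _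
  have hA : A.time κ = (A (0 : Fin 2)).time κ + (A (1 : Fin 2)).time κ := Fin.sum_univ_two _
  have hc := commit.time_le κ
  have hr := respond.time_le κ
  have hq : q * (commit.time κ + respond.time κ + 66) ≤
      q * ((commit.time 0 + respond.time 0 + 66) * totalOpCost κ) :=
    Nat.mul_le_mul_left _ (by nlinarith)
  have hl : (learnProg scheme.prover B).time κ =
      B.time κ + q * (commit.time κ + respond.time κ + 66) + 6 := by
    rw [time_learnProg, hP]
    rfl
  simp only [trial, Prog.time, hl, hA]
  nlinarith

/-- The cost in each iteration of the inverter apart from the running time of the attacker. -/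
def overhead : ℕ :=
  randomizedKeys.time 0 + (attempt .nil).time 0 + (rewind .nil).time 0 + commit.time 0 +
    respond.time 0 + 110

theorem time_inverter_le (κ : Op → ℕ) (N : ℕ) {q : ℕ} (hq : 1 ≤ q)
    (B : CheatingVerifier scheme.rounds q) (A : Machine scheme.rounds) :
    (inverter N B A).time κ ≤ (extract.time 0 + 20) * totalOpCost κ +
      N * (B.time κ + 2 * A.time κ + overhead * q * totalOpCost κ) := by
  have h1 := one_le_totalOpCost κ
  have he := extract.time_le κ
  have ht := time_trial_le κ B A
  have hr := time_rewind_le κ (A (1 : Fin 2))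
  have hA : A.time κ = (A (0 : Fin 2)).time κ + (A (1 : Fin 2)).time κ := Fin.sum_univ_two _
  have hqτ : totalOpCost κ ≤ q * totalOpCost κ := Nat.le_mul_of_pos_left _ hq
  -- A trial runs `B` and both activations of `A`, a rewinding the second activation again. This is
  -- where the `3 t` of the theorem comes from.
  have hsum : (trial B A).time κ + 7 + ((rewind (A (1 : Fin 2))).time κ + 7) ≤
      B.time κ + 2 * A.time κ + overhead * q * totalOpCost κ := by
    -- Here `44 = 30 + 7 + 7` collects the constants of `time_trial_le` and of the two retry loops;
    -- the `66` per session completes the `110` in `overhead`.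
    have hm : (randomizedKeys.time 0 + (attempt .nil).time 0 + (rewind .nil).time 0 + 44) *
        totalOpCost κ ≤ (randomizedKeys.time 0 + (attempt .nil).time 0 + (rewind .nil).time 0 + 44)
          * (q * totalOpCost κ) := Nat.mul_le_mul_left _ hqτ
    simp only [overhead]
    nlinarith
  have hN := Nat.mul_le_mul_left N hsum
  simp only [inverter, Prog.time, Prog.time_retry]
  nlinarith

end OneWayId

/-! ### The security theorem -/

theorem theoremt :
    ∃ k₀ kₛ : ℕ, ∀ (p : ℕ) [Fact p.Prime] (G₁ : Type*) (G₂ : Type*)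
      [CommGroup G₁] [CommGroup G₂] [Fintype G₁] [Fintype G₂] (S : Setting G₁ G₂) (κ : Op → ℕ)
      (c₀ cₛ : ℝ) (t t' ε ε' : ℝ) (q : ℕ),
      IsCyclic G₁ → IsCyclic G₂ → Fintype.card G₁ = p → Fintype.card G₂ = p →
      IsCryptographicPairing S.e →
      c₀ = k₀ * totalOpCost κ → cₛ = kₛ * totalOpCost κ →
      IsOneWayPairing p S κ t' ε' → ε' ≤ 3 / 16 → 17 ≤ p → 1 ≤ q →
      (OneWayId.scheme.prover.time κ : ℝ) ≤ t → (OneWayId.scheme.verifier.time κ : ℝ) ≤ t →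
      2 / (p : ℝ) < ε → c₀ + 3 * (t + cₛ * q) / ε ≤ t' →
      (OneWayId.scheme.gen.time κ : ℝ) ≤ c₀ ∧ OneWayId.scheme.IsSecure p S κ t q ε := by
  obtain ⟨kg, hgen⟩ : ∃ k : ℕ, ∀ κ, OneWayId.scheme.gen.time κ ≤ k * totalOpCost κ :=
    ⟨_, fun κ => Prog.time_le κ _⟩
  obtain ⟨ku, hguess⟩ : ∃ k : ℕ, ∀ κ n,
      (Prog.retry n OneWayId.guess).time κ ≤ (n * k + 7) * totalOpCost κ :=
    ⟨_, OneWayId.time_bruteForce_le⟩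
  obtain ⟨kx, ko, hinv⟩ : ∃ kx ko : ℕ, ∀ κ N q, 1 ≤ q →
      ∀ (B : CheatingVerifier OneWayId.scheme.rounds q) (A : Machine OneWayId.scheme.rounds),
      (OneWayId.inverter N B A).time κ ≤ kx * totalOpCost κ +
        N * (B.time κ + 2 * A.time κ + ko * q * totalOpCost κ) :=
    ⟨_, _, fun κ N _ hq B A => OneWayId.time_inverter_le κ N hq B A⟩
  -- `k₀` covers key generation, extraction and the fixed cost of guessing. `kₛ` covers the overhead
  -- per iteration, and `100 * ku` pays for `p ≤ 100 / ε` guesses.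
  refine ⟨kg + kx + 7, 100 * ku + ko, ?_⟩
  intro p _ G₁ G₂ _ _ _ _ S κ c₀ cₛ t t' ε ε' q hc _ h₁ h₂ he hc₀ hcₛ hone hε' hp hq hPt hVt hε ht'
  have hp0 : (0 : ℝ) < p := by exact_mod_cast (Fact.out : p.Prime).pos
  have hε0 : 0 < ε := lt_trans (by positivity) hε
  have ht0 : 0 ≤ t := le_trans (Nat.cast_nonneg _) hPt
  have hq1 : (1 : ℝ) ≤ q := by exact_mod_cast hq
  replace hgen := hgen κ
  replace hguess := hguess κ p
  replace hinv := fun N => hinv κ N q hq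
  generalize totalOpCost κ = τ at *
  have hτ0 : (0 : ℝ) ≤ τ := Nat.cast_nonneg _
  have hkg : (0 : ℝ) ≤ kg := Nat.cast_nonneg _
  have hkx : (0 : ℝ) ≤ kx := Nat.cast_nonneg _
  have hku : (0 : ℝ) ≤ ku := Nat.cast_nonneg _
  have hko : (0 : ℝ) ≤ ko := Nat.cast_nonneg _
  push_cast at hc₀ hcₛ
  have hcontra : ∀ C : Prog, 3 / 16 ≤ (inversionRun p S C true).toReal → t' < C.time κ := by
    intro C hC
    by_contra! h
    exact absurd (hone C h) (by linarith)
  refine ⟨?_, hPt, hVt, OneWayId.eval_honestRun hc h₂ he, ?_⟩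
  · have h : (OneWayId.scheme.gen.time κ : ℝ) ≤ kg * τ := by exact_mod_cast hgen
    rw [hc₀]
    linarith [mul_nonneg hkx hτ0]
  intro α B hB A hA
  by_contra! ha
  have hε1 : ε ≤ 1 := ha.trans (ENNReal.toReal_le_of_le_ofReal zero_le_one (by
    simpa using PMF.coe_le_one _ _))
  have hεinv : 1 ≤ 1 / ε := by
    rw [le_div_iff₀ hε0]
    linarith
  have hform : 3 * (t + cₛ * q) / ε = 1 / ε * (3 * t + 3 * (cₛ * q)) := by ring
  have hcq : cₛ * q = 100 * ku * (τ * q) + ko * (τ * q) := by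
    rw [hcₛ]
    ring
  have hτq : (τ : ℝ) ≤ τ * q := le_mul_of_one_le_right hτ0 hq1
  have hτq0 : (0 : ℝ) ≤ τ * q := hτ0.trans hτq
  -- For small `ε` guessing fits into the time bound; otherwise the errors of order `1/p` are
  -- negligible against `ε`, and the attacker is rewound with `N = ⌊1/ε⌋`.
  rcases le_or_gt ε (100 / p) with hsmall | hlarge
  · have hlt := hcontra _ (OneWayId.bruteForce_success h₁ h₂ he hp)
    have htime : ((Prog.retry p OneWayId.guess).time κ : ℝ) ≤ (p * ku + 7) * τ := by
      exact_mod_cast hguess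
    have hpε : (p : ℝ) ≤ 1 / ε * 100 := by
      rw [one_div_mul_eq_div, le_div_iff₀ hε0]
      rw [le_div_iff₀ hp0] at hsmall
      linarith
    have hbound : p * ((ku : ℝ) * τ) ≤ 1 / ε * (3 * t + 3 * (cₛ * q)) := by
      calc p * ((ku : ℝ) * τ) ≤ 1 / ε * 100 * (ku * τ) := by gcongr
        _ = 1 / ε * (100 * ku * τ) := by ring
        _ ≤ 1 / ε * (3 * t + 3 * (cₛ * q)) := by
          gcongr
          rw [hcq]
          linarith [mul_nonneg hku hτq0, mul_nonneg hko hτq0, mul_le_mul_of_nonneg_left hτq hku]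
    rw [hform, hc₀] at ht'
    linarith [mul_nonneg hkx hτ0, mul_nonneg hkg hτ0]
  · have hN1 : 1 ≤ ⌊1 / ε⌋₊ := Nat.le_floor (by simpa using hεinv)
    have hN : (⌊1 / ε⌋₊ : ℝ) ≤ 1 / ε := Nat.floor_le (by positivity)
    have hlt := hcontra _ (OneWayId.inverter_success hc h₁ h₂ he hε0 hlarge hN
      (Nat.lt_floor_add_one _) hN1 α B A ha)
    have htime : ((OneWayId.inverter ⌊1 / ε⌋₊ B A).time κ : ℝ) ≤ kx * τ +
        ⌊1 / ε⌋₊ * (B.time κ + 2 * A.time κ + ko * q * τ) := by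
      exact_mod_cast hinv ⌊1 / ε⌋₊ B A
    have hbound : ⌊1 / ε⌋₊ * ((B.time κ : ℝ) + 2 * A.time κ + ko * q * τ) ≤
        1 / ε * (3 * t + 3 * (cₛ * q)) := by
      refine mul_le_mul hN ?_ (by positivity) (by positivity)
      rw [hcq]
      linarith [mul_nonneg hku hτq0, mul_nonneg hko hτq0]
    rw [hform, hc₀] at ht'
    linarith [mul_nonneg hkg hτ0]
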